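/- Let $B_2\subset\mathbb{R}^2$ be the open unit disc. Let $0<z_1<z_2<\cdots$ be the increasing enumeration of the numbers $z>0$ such that $z^2$ is an eigenvalue of $-\Delta$ on $B_2$ with vanishing Dirichlet boundary values having a radial eigenfunction, and let $e_n$ be a real-valued radial eigenfunction with eigenvalue $z_n^2$ and $\|e_n\|_{L^2(B_2)}=1$. Let $(g_n)_{n\ge1}$ be independent centred complex Gaussian variables with $\mathbb{E}|g_n|^2=1$, whose real and imaginary parts are independent with variance $\tfrac12$. Let $\mu_F$ (the free Gaussian measure) be the law on $L^2(B_2;\mathbb{C})$ of $$\phi=\frac1\pi\sum_{n\ge1}\frac{g_n}{z_n}\,e_n .$$ Then there are $\rho_0>0$ and constants $C>1$, $A<\infty$ such that for every $0<\rho<\rho_0$ the following hold. (i) For every $\lambda>0$, $$\mu_F\big(\{\phi:\ \|\phi\|_{L^4(B_2)}>\lambda,\ \|\phi\|_{L^2(B_2)}<\rho\}\big)\le A\,e^{-C\lambda^4},$$ where $\|\phi\|_{L^4(B_2)}\in[0,\infty]$. (ii) The measure $$\exp\Big(\int_{B_2}|\phi|^4\,dx\Big)\,\chi_{\{\|\phi\|_{L^2(B_2)}<\rho\}}(\phi)\,d\mu_F(\phi)$$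 is finite, where $\int_{B_2}|\phi|^4\,dx\in[0,\infty]$ and $\exp(\infty)=\infty$. -/

import Mathlib

open MeasureTheory ProbabilityTheory
open scoped ENNReal NNReal

namespace RadialDisc

/-- The Euclidean plane `ℝ²`. -/
abbrev Plane : Type := EuclideanSpace ℝ (Fin 2)

/-- The open unit disc `B₂ ⊂ ℝ²`. -/
def disc : Set Plane := Metric.ball 0 1

/-- Lebesgue measure on the unit disc. -/
noncomputable def discMeasure : Measure Plane := volume.restrict disc

/-- The complex Hilbert space `L²(B₂; ℂ)`. -/
abbrev DiscL2 : Type := Lp ℂ 2 discMeasure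

noncomputable instance instMeasurableSpaceDiscL2 : MeasurableSpace DiscL2 := borel DiscL2

instance instBorelSpaceDiscL2 : BorelSpace DiscL2 := ⟨rfl⟩

/-- `f` is a radial eigenfunction of `-Δ` on the unit disc with vanishing Dirichlet boundary
values and eigenvalue `z²`, i.e. a nontrivial radial classical solution of `-Δ f = z² f` in the
open disc, continuous up to the boundary circle and zero there.
The values of `f` outside the closed disc play no role. -/
structure IsRadialDirichletEigenfunction (z : ℝ) (f : Plane → ℝ) : Prop where
  continuousOn : ContinuousOn f (Metric.closedBall 0 1)
  contDiffOn : ContDiffOn ℝ 2 f disc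
  radial : ∀ x ∈ disc, ∀ y ∈ disc, ‖x‖ = ‖y‖ → f x = f y
  eigen : ∀ x ∈ disc, -Laplacian.laplacian f x = z ^ 2 * f x
  boundary : ∀ x ∈ Metric.sphere (0 : Plane) 1, f x = 0
  nontrivial : ∃ x ∈ disc, f x ≠ 0

/-- The set of radial Dirichlet frequencies of the disc: the `z > 0` such that `z²` is an
eigenvalue of the Dirichlet Laplacian with a radial eigenfunction. -/
def radialFrequencies : Set ℝ := {z | 0 < z ∧ ∃ f, IsRadialDirichletEigenfunction z f}

/-- The radial frequencies listed in increasing order; `radialFreq n` is the `(n+1)`-st smallest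
one. -/
noncomputable def radialFreq : ℕ → ℝ
  | 0 => sInf radialFrequencies
  | n + 1 => sInf (radialFrequencies ∩ Set.Ioi (radialFreq n))

/-- `e ∈ L²(B₂; ℂ)` is an `L²`-normalized (real-valued) radial Dirichlet eigenfunction of
eigenvalue `z²`. -/
def IsNormalizedEigenvector (z : ℝ) (e : DiscL2) : Prop :=
  ‖e‖ = 1 ∧ ∃ f, IsRadialDirichletEigenfunction z f ∧ ∀ᵐ x ∂discMeasure, e x = (f x : ℂ)

/-- The `L²`-normalized radial eigenfunction with frequency `radialFreq n`. The eigenspaces are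
one-dimensional, so that it is determined up to a sign. -/
noncomputable def radialEigenfunction (n : ℕ) : DiscL2 :=
  Classical.epsilon (IsNormalizedEigenvector (radialFreq n))

/-- The normalized complex Gaussian law: independent centred real and imaginary parts of
variance `1/2`, so that `E|g|² = 1`. -/
noncomputable def complexGaussian : Measure ℂ :=
  ((gaussianReal 0 (1 / 2)).prod (gaussianReal 0 (1 / 2))).map
    Complex.measurableEquivRealProd.symm

instance instIsProbabilityMeasureComplexGaussian : IsProbabilityMeasure complexGaussian :=
  Measure.isProbabilityMeasure_map (by fun_prop)

/-- The law of a sequence of independent normalized complex Gaussian variables. -/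
noncomputable def gaussianSequence : Measure (ℕ → ℂ) :=
  Measure.infinitePi fun _ : ℕ => complexGaussian

instance instIsProbabilityMeasureGaussianSequence : IsProbabilityMeasure gaussianSequence := by
  unfold gaussianSequence; infer_instance

/-- The random series `π⁻¹ ∑ₙ (gₙ / zₙ) eₙ` in `L²(B₂; ℂ)` (it converges for almost every
Gaussian sequence `g`). -/
noncomputable def randomSeries (g : ℕ → ℂ) : DiscL2 :=
  ((Real.pi⁻¹ : ℝ) : ℂ) • ∑' n : ℕ, (g n / (radialFreq n : ℂ)) • radialEigenfunction n

/-- The free Gaussian measure `μ_F`: the law of `π⁻¹ ∑ₙ (gₙ / zₙ) eₙ` on `L²(B₂; ℂ)`. -/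
noncomputable def freeMeasure : Measure DiscL2 := gaussianSequence.map randomSeries

theorem measurable_randomSeries : Measurable randomSeries := by
  have h : StronglyMeasurable fun g : ℕ → ℂ =>
      ∑' n : ℕ, (g n / (radialFreq n : ℂ)) • radialEigenfunction n :=
    StronglyMeasurable.tsum fun n => by
      have hn : StronglyMeasurable fun g : ℕ → ℂ => g n / (radialFreq n : ℂ) :=
        ((measurable_pi_apply n).div_const _).stronglyMeasurable
      exact hn.smul_const _
  exact (continuous_const_smul ((Real.pi⁻¹ : ℝ) : ℂ)).measurable.comp h.measurable

instance instIsProbabilityMeasureFreeMeasure : IsProbabilityMeasure freeMeasure :=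
  Measure.isProbabilityMeasure_map measurable_randomSeries.aemeasurable

/-- The norm `‖φ‖_{L⁴(B₂)} ∈ [0, ∞]` of `φ ∈ L²(B₂; ℂ)`. -/
noncomputable def normL4 (φ : DiscL2) : ℝ≥0∞ := eLpNorm φ 4 discMeasure

/-- The density `exp(∫_{B₂} |φ|⁴ dx) · χ_{‖φ‖_{L²} < ρ}` with values in `[0, ∞]`; the integral is
a Lebesgue integral with values in `[0, ∞]`, and `exp ∞ = ∞`. -/
noncomputable def focusingDensity (ρ : ℝ) : DiscL2 → ℝ≥0∞ :=
  Set.indicator {φ | ‖φ‖ < ρ} fun φ =>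
    EReal.exp (((∫⁻ x, ‖φ x‖ₑ ^ 4 ∂discMeasure : ℝ≥0∞)) : EReal)

end RadialDisc

/-! Fix a level `l` and cut the random series at a frequency index `N` comparable to `l ^ 4`. If the
field exceeds `l` in L⁴, then its low part or its high part exceeds `l / 2`.

Low part: for radial functions vanishing on the circle, the fourth power of the L⁴ norm is at most a
constant times the squared L² norm times the Dirichlet energy (`radial_gagliardo_nirenberg`). The
cutoff and Bessel's inequality make the first factor smaller than `ρ ^ 2`. The weights `1 / zₙ`
cancel in the second, leaving at most `∑ ‖gₙ‖ ^ 2` over `n < N`. This sum would have to exceed `l ^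
4 / (32 ρ ^ 2)`, which has probability at most `K ^ N exp(-κ l ^ 4 / (32 ρ ^ 2))`. Since `N` is of
order `l ^ 4`, a small `ρ` beats the factor `K ^ N`.

High part: no cutoff is used. The normalized modes satisfy `r eₙ(r) ^ 4 ≤ 9 zₙ`, and the `zₙ` grow
linearly, so the pointwise variance of the tail at radius `r` is `O(r ^ (-1/2) N ^ (-1/2))`. Its
square is `O(1 / (r N))`, and `1 / r` is integrable on the disc. Gaussian moment bounds of order
`4k` and Markov's inequality give probability at most `2 (c k ^ 2 / (N l ^ 4)) ^ k`, which is
exponentially small in `l ^ 4` when `k` is of order `l ^ 4` and `N` is a large multiple of `l ^ 4`.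

Together these give the rate `C = 2`. As it exceeds 1, a layer-cake sum shows that `exp ∫ |φ| ^ 4`
is integrable under the cutoff.

The spectral input comes from `J₀`: a radial eigenfunction is a multiple of `J₀(z |x|)` with `J₀(z)
= 0`. The energy of `√t J₀` is bounded above and below, which controls the size of `J₀`, its slope
at zeros and the gaps between zeros. -/

namespace RadialDisc

/-! ### Power series of `J₀` and Bessel's equation -/

/-- The `k`-th Taylor coefficient of `besselSeries m`. -/
noncomputable def besselCoeff (m k : ℕ) : ℝ :=
  (-1 / 4) ^ (k + m) / ((k.factorial : ℝ) * ((k + m).factorial : ℝ))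

/-- The entire functions `∑ₖ (-1/4)^(k+m) / (k! (k+m)!) sᵏ`; the Bessel function `J₀(t)` is
`besselSeries 0 (t ^ 2)`, and `besselSeries m` is the `m`-th derivative of `besselSeries 0`. -/
noncomputable def besselSeries (m : ℕ) (s : ℝ) : ℝ := ∑' k, besselCoeff m k * s ^ k

theorem abs_besselCoeff_le (m k : ℕ) : |besselCoeff m k| ≤ 1 / (k.factorial : ℝ) := by
  unfold besselCoeff
  rw [abs_div, abs_mul, Nat.abs_cast, Nat.abs_cast, abs_pow]
  have h1 : (1 : ℝ) ≤ ((k + m).factorial : ℝ) := by exact_mod_cast Nat.factorial_pos _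
  have h2 : (0 : ℝ) < (k.factorial : ℝ) := by exact_mod_cast Nat.factorial_pos _
  have h3 : |(-1 / 4 : ℝ)| ^ (k + m) ≤ 1 := by
    apply pow_le_one₀ (abs_nonneg _)
    rw [abs_le]; constructor <;> norm_num
  gcongr
  nlinarith

theorem besselCoeff_succ (m k : ℕ) :
    besselCoeff m (k + 1) * ((k + 1 : ℕ) : ℝ) = besselCoeff (m + 1) k := by
  unfold besselCoeff
  have h : k + 1 + m = k + (m + 1) := by ring
  rw [h, Nat.factorial_succ]
  have h2 : (0 : ℝ) < (k.factorial : ℝ) := by exact_mod_cast Nat.factorial_pos _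
  have h3 : (0 : ℝ) < ((k + (m + 1)).factorial : ℝ) := by exact_mod_cast Nat.factorial_pos _
  push_cast
  field_simp

theorem summable_besselSeries (m : ℕ) (s : ℝ) : Summable fun k => besselCoeff m k * s ^ k := by
  refine Summable.of_norm_bounded (g := fun k : ℕ => |s| ^ k / (k.factorial : ℝ))
    (Real.summable_pow_div_factorial |s|) fun k => ?_
  rw [Real.norm_eq_abs, abs_mul, abs_pow]
  calc |besselCoeff m k| * |s| ^ k ≤ 1 / (k.factorial : ℝ) * |s| ^ k := by
        gcongr; exact abs_besselCoeff_le m k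
    _ = _ := by ring

theorem hasDerivAt_besselSeries (m : ℕ) (s : ℝ) :
    HasDerivAt (besselSeries m) (besselSeries (m + 1) s) s := by
  -- Termwise differentiation needs a summable majorant on a neighbourhood of `s`; the ball of
  -- radius `|s| + 1` is one on which the derived series is dominated by its value at `R`.
  set R : ℝ := |s| + 1 with hR
  have hRpos : 0 < R := by positivity
  have key := hasDerivAt_tsum_of_isPreconnected (𝕜 := ℝ) (F := ℝ)
    (g := fun k y => besselCoeff m k * y ^ k)
    (g' := fun k y => besselCoeff m k * ((k : ℝ) * y ^ (k - 1)))
    (u := fun k : ℕ => |besselCoeff m k| * ((k : ℝ) * R ^ (k - 1)))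
    (t := Metric.ball (0 : ℝ) R) (y₀ := s) (y := s) ?_ Metric.isOpen_ball
    (convex_ball (0 : ℝ) R).isPreconnected ?_ ?_ ?_ (summable_besselSeries m s) ?_
  · refine key.congr_deriv ?_
    symm
    rw [besselSeries, eq_comm, Summable.tsum_eq_zero_add]
    · simp only [Nat.cast_zero, zero_mul, mul_zero, zero_add]
      congr 1
      ext k
      rw [← besselCoeff_succ]
      simp
      ring
    · rw [← summable_nat_add_iff 1]
      refine (summable_besselSeries (m + 1) s).congr fun k => ?_
      rw [← besselCoeff_succ]
      simp
      ring
  · rw [← summable_nat_add_iff 1]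
    refine (summable_besselSeries (m + 1) R).norm.congr fun k => ?_
    rw [← besselCoeff_succ, norm_mul, norm_mul, Real.norm_eq_abs, norm_pow, Real.norm_eq_abs,
      Real.norm_eq_abs, Nat.abs_cast, abs_of_pos hRpos]
    simp
    ring
  · intro n y _
    exact (hasDerivAt_pow n y).const_mul _
  · intro n y hy
    rw [mem_ball_zero_iff] at hy
    rw [norm_mul, norm_mul, norm_pow]
    simp only [Real.norm_eq_abs, Nat.abs_cast] at *
    gcongr
  · simp only [mem_ball_zero_iff, Real.norm_eq_abs, hR]; linarith
  · simp only [mem_ball_zero_iff, Real.norm_eq_abs, hR]; linarith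

theorem deriv_besselSeries (m : ℕ) : deriv (besselSeries m) = besselSeries (m + 1) :=
  funext fun s => (hasDerivAt_besselSeries m s).deriv

theorem contDiff_besselSeries (n m : ℕ) : ContDiff ℝ n (besselSeries m) := by
  induction n generalizing m with
  | zero =>
    exact contDiff_zero.2 (continuous_iff_continuousAt.2 fun s =>
      (hasDerivAt_besselSeries m s).continuousAt)
  | succ n ih =>
    rw [Nat.cast_succ, contDiff_succ_iff_deriv]
    refine ⟨fun s => (hasDerivAt_besselSeries m s).differentiableAt, by simp, ?_⟩
    rw [deriv_besselSeries]
    exact ih (m + 1)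

theorem besselSeries_zero_zero : besselSeries 0 0 = 1 := by
  unfold besselSeries
  rw [tsum_eq_single 0 (fun k hk => by simp [hk])]
  simp [besselCoeff]

/-- The power series form of Bessel's equation. -/
theorem besselSeries_ode (s : ℝ) :
    s * besselSeries 2 s + besselSeries 1 s + besselSeries 0 s / 4 = 0 := by
  have h2 : s * besselSeries 2 s = ∑' k, besselCoeff 1 k * (k : ℝ) * s ^ k := by
    rw [Summable.tsum_eq_zero_add]
    · simp only [besselSeries, CharP.cast_eq_zero, mul_zero, zero_mul, zero_add]
      rw [← tsum_mul_left]
      congr 1; ext k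
      rw [← besselCoeff_succ]; ring
    · rw [← summable_nat_add_iff 1]
      refine ((summable_besselSeries 2 s).mul_left s).congr fun k => ?_
      rw [← besselCoeff_succ]; ring
  have hs2 : Summable fun k => besselCoeff 1 k * (k : ℝ) * s ^ k := by
    rw [← summable_nat_add_iff 1]
    refine ((summable_besselSeries 2 s).mul_left s).congr fun k => ?_
    rw [← besselCoeff_succ]; ring
  rw [h2, besselSeries, besselSeries, ← tsum_div_const,
    ← Summable.tsum_add hs2 (summable_besselSeries 1 s),
    ← Summable.tsum_add (hs2.add (summable_besselSeries 1 s))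
      ((summable_besselSeries 0 s).div_const 4)]
  convert tsum_zero with k
  unfold besselCoeff
  have e1 : (k + 1).factorial = (k + 1) * k.factorial := Nat.factorial_succ k
  have h1 : (0 : ℝ) < (k.factorial : ℝ) := by exact_mod_cast Nat.factorial_pos _
  rw [e1, pow_succ]
  simp only [add_zero]
  push_cast
  field_simp
  ring

/-- The Bessel function `J₀`. -/
noncomputable def besselJ (t : ℝ) : ℝ := besselSeries 0 (t ^ 2)

/-- The derivative of the Bessel function `J₀`. -/
noncomputable def besselJ' (t : ℝ) : ℝ := 2 * t * besselSeries 1 (t ^ 2)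

theorem hasDerivAt_besselJ (t : ℝ) : HasDerivAt besselJ (besselJ' t) t := by
  have := (hasDerivAt_besselSeries 0 (t ^ 2)).comp t (hasDerivAt_pow 2 t)
  refine this.congr_deriv ?_
  simp [besselJ']; ring

theorem hasDerivAt_besselJ'_aux (t : ℝ) :
    HasDerivAt besselJ' (2 * besselSeries 1 (t ^ 2) + 4 * t ^ 2 * besselSeries 2 (t ^ 2)) t := by
  have := ((hasDerivAt_id t).const_mul 2).mul
    ((hasDerivAt_besselSeries 1 (t ^ 2)).comp t (hasDerivAt_pow 2 t))
  refine this.congr_deriv ?_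
  simp; ring

theorem hasDerivAt_besselJ' {t : ℝ} (ht : t ≠ 0) :
    HasDerivAt besselJ' (-besselJ' t / t - besselJ t) t := by
  refine (hasDerivAt_besselJ'_aux t).congr_deriv ?_
  have := besselSeries_ode (t ^ 2)
  unfold besselJ' besselJ
  field_simp
  linear_combination 4 * this

theorem continuous_besselJ : Continuous besselJ :=
  continuous_iff_continuousAt.2 fun t => (hasDerivAt_besselJ t).continuousAt

theorem continuous_besselJ' : Continuous besselJ' :=
  continuous_iff_continuousAt.2 fun t => (hasDerivAt_besselJ'_aux t).continuousAt

theorem besselJ_zero : besselJ 0 = 1 := by simp [besselJ, besselSeries_zero_zero]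

theorem besselJ'_zero : besselJ' 0 = 0 := by simp [besselJ']

/-- `(t J₀')' = - t J₀`. -/
theorem hasDerivAt_mul_besselJ' (t : ℝ) :
    HasDerivAt (fun t => t * besselJ' t) (-(t * besselJ t)) t := by
  refine ((hasDerivAt_id t).mul (hasDerivAt_besselJ'_aux t)).congr_deriv ?_
  have := besselSeries_ode (t ^ 2)
  simp only [id, besselJ', besselJ]
  linear_combination 4 * t * this

/-! ### Bounds for `J₀` and its derivative -/

/-- Bessel's equation is a damped oscillator: the energy has derivative `-2 J₀' ^ 2 / t`, so it
never exceeds its value 1 at the origin. -/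
theorem besselJ_energy_le {t : ℝ} (ht : 0 ≤ t) : besselJ t ^ 2 + besselJ' t ^ 2 ≤ 1 := by
  have hanti : AntitoneOn (fun t => besselJ t ^ 2 + besselJ' t ^ 2) (Set.Ici 0) := by
    refine antitoneOn_of_hasDerivWithinAt_nonpos (f' := fun t => -2 * besselJ' t ^ 2 / t)
      (convex_Ici 0) ?_ ?_ ?_
    · exact ((continuous_besselJ.pow 2).add (continuous_besselJ'.pow 2)).continuousOn
    · intro x hx
      rw [interior_Ici, Set.mem_Ioi] at hx
      refine (((hasDerivAt_besselJ x).pow 2).add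
        ((hasDerivAt_besselJ' hx.ne').pow 2)).hasDerivWithinAt.congr_deriv ?_
      field_simp
      simp
      ring
    · intro x hx
      rw [interior_Ici, Set.mem_Ioi] at hx
      have : 0 ≤ besselJ' x ^ 2 / x := by positivity
      simp only [neg_mul, neg_div, mul_div_assoc]; linarith
  have := hanti (Set.mem_Ici.2 le_rfl) ht ht
  simpa [besselJ_zero, besselJ'_zero] using this

theorem abs_besselJ_le_one {t : ℝ} (ht : 0 ≤ t) : |besselJ t| ≤ 1 := by
  rw [abs_le_one_iff_mul_self_le_one]
  nlinarith [besselJ_energy_le ht, sq_nonneg (besselJ' t)]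

/-- Integrate `(t J₀')' = -t J₀ ≥ -t` from 0. -/
theorem neg_half_le_besselJ' {t : ℝ} (ht : 0 < t) : -(t / 2) ≤ besselJ' t := by
  have hmono : MonotoneOn (fun t => t * besselJ' t + t ^ 2 / 2) (Set.Ici 0) := by
    refine monotoneOn_of_hasDerivWithinAt_nonneg (f' := fun t => t * (1 - besselJ t))
      (convex_Ici 0) ?_ ?_ ?_
    · exact ((continuous_id.mul continuous_besselJ').add (by fun_prop)).continuousOn
    · intro x hx
      refine ((hasDerivAt_mul_besselJ' x).add
        ((hasDerivAt_pow 2 x).div_const 2)).hasDerivWithinAt.congr_deriv ?_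
      simp; ring
    · intro x hx
      rw [interior_Ici, Set.mem_Ioi] at hx
      have := (abs_le.1 (abs_besselJ_le_one hx.le)).2
      exact mul_nonneg hx.le (by linarith)
  have := hmono (Set.mem_Ici.2 le_rfl) (Set.mem_Ici.2 ht.le) ht.le
  simp at this
  by_contra! hc
  nlinarith

theorem one_sub_le_besselJ {t : ℝ} (ht : 0 ≤ t) : 1 - t ^ 2 / 4 ≤ besselJ t := by
  have hmono : MonotoneOn (fun t => besselJ t + t ^ 2 / 4) (Set.Ici 0) := by
    refine monotoneOn_of_hasDerivWithinAt_nonneg (f' := fun t => besselJ' t + t / 2)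
      (convex_Ici 0) ?_ ?_ ?_
    · exact (continuous_besselJ.add (by fun_prop)).continuousOn
    · intro x hx
      refine ((hasDerivAt_besselJ x).add
        ((hasDerivAt_pow 2 x).div_const 4)).hasDerivWithinAt.congr_deriv ?_
      simp; ring
    · intro x hx
      rw [interior_Ici, Set.mem_Ioi] at hx
      linarith [neg_half_le_besselJ' hx]
  have := hmono (Set.mem_Ici.2 le_rfl) (Set.mem_Ici.2 ht) ht
  simp [besselJ_zero] at this
  linarith

/-- The energy of `√t J₀(t)`. -/
noncomputable def besselEnergy (t : ℝ) : ℝ :=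
  t * besselJ t ^ 2 + t * (besselJ' t + besselJ t / (2 * t)) ^ 2

/-- The derivative of `besselEnergy`. -/
noncomputable def besselEnergy' (t : ℝ) : ℝ :=
  -(1 / (2 * t)) * (besselJ t * (besselJ' t + besselJ t / (2 * t)))

/-- The function `u = √t J₀` solves `u'' + (1 + 1 / (4 t ^ 2)) u = 0`, and the energy is `u ^ 2 + u'
^ 2`; hence its derivative is `-u u' / (2 t ^ 2)`. -/
theorem hasDerivAt_besselEnergy {t : ℝ} (ht : 0 < t) :
    HasDerivAt besselEnergy (besselEnergy' t) t := by
  have h0 : (2 * t) ≠ 0 := by positivity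
  have hJ := hasDerivAt_besselJ t
  have hD := hasDerivAt_besselJ' ht.ne'
  have := ((hasDerivAt_id t).mul (hJ.pow 2)).add ((hasDerivAt_id t).mul
    ((hD.add (hJ.div ((hasDerivAt_id t).const_mul 2) h0)).pow 2))
  refine this.congr_deriv ?_
  simp [besselEnergy']
  field_simp
  ring

theorem abs_besselEnergy'_le {t : ℝ} (ht : 0 < t) :
    |besselEnergy' t| ≤ besselEnergy t / (4 * t ^ 2) := by
  have : besselEnergy t / (4 * t ^ 2) =
      1 / (4 * t) * (besselJ t ^ 2 + (besselJ' t + besselJ t / (2 * t)) ^ 2) := by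
    unfold besselEnergy; field_simp
  rw [this, besselEnergy', abs_mul, abs_neg, abs_of_pos (by positivity : 0 < 1 / (2 * t))]
  have h2 : |besselJ t * (besselJ' t + besselJ t / (2 * t))| ≤
      (besselJ t ^ 2 + (besselJ' t + besselJ t / (2 * t)) ^ 2) / 2 := by
    rw [abs_le]
    constructor <;> nlinarith [sq_nonneg (besselJ t + (besselJ' t + besselJ t / (2 * t))),
      sq_nonneg (besselJ t - (besselJ' t + besselJ t / (2 * t)))]
  calc _ ≤ 1 / (2 * t) * ((besselJ t ^ 2 + (besselJ' t + besselJ t / (2 * t)) ^ 2) / 2) := by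
        gcongr
    _ = _ := by field_simp; ring

/-- Grönwall in both directions: the relative change of the energy is at most `1 / (4 t ^ 2)`, whose
integral over `[1, ∞)` is `1 / 4`. So the energy stays within factors `exp (± 1 / 4)` of its value
at 1. -/
theorem besselEnergy_mem {t : ℝ} (ht : 1 ≤ t) :
    1 / 4 ≤ besselEnergy t ∧ besselEnergy t ≤ 4 := by
  have hexp : ∀ x : ℝ, x ≠ 0 → HasDerivAt (fun t : ℝ => 1 / (4 * t)) (-(1 / (4 * x ^ 2))) x := by
    intro x hx
    have := ((hasDerivAt_id x).const_mul 4).fun_inv (by simpa using hx)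
    simp only [one_div]
    refine this.congr_deriv ?_
    simp; field_simp
  have hcont : ContinuousOn besselEnergy (Set.Ici 1) := fun x hx =>
    (hasDerivAt_besselEnergy (lt_of_lt_of_le one_pos hx)).continuousAt.continuousWithinAt
  have hcont2 : ContinuousOn (fun t : ℝ => 1 / (4 * t)) (Set.Ici 1) := fun x hx =>
    (hexp x (lt_of_lt_of_le one_pos hx).ne').continuousAt.continuousWithinAt
  have hanti : AntitoneOn (fun t => besselEnergy t * Real.exp (1 / (4 * t))) (Set.Ici 1) := by
    refine antitoneOn_of_hasDerivWithinAt_nonpos (f' := fun t => (besselEnergy' t -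
      besselEnergy t / (4 * t ^ 2)) * Real.exp (1 / (4 * t))) (convex_Ici 1) ?_ ?_ ?_
    · exact hcont.mul (Real.continuous_exp.comp_continuousOn hcont2)
    · intro x hx
      rw [interior_Ici, Set.mem_Ioi] at hx
      have hx0 : 0 < x := by linarith
      refine ((hasDerivAt_besselEnergy hx0).mul
        (hexp x hx0.ne').exp).hasDerivWithinAt.congr_deriv ?_
      ring
    · intro x hx
      rw [interior_Ici, Set.mem_Ioi] at hx
      have := (abs_le.1 (abs_besselEnergy'_le (by linarith : 0 < x))).2
      exact mul_nonpos_of_nonpos_of_nonneg (by linarith) (Real.exp_pos _).le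
  have hmono : MonotoneOn (fun t => besselEnergy t * Real.exp (-(1 / (4 * t)))) (Set.Ici 1) := by
    refine monotoneOn_of_hasDerivWithinAt_nonneg (f' := fun t => (besselEnergy' t +
      besselEnergy t / (4 * t ^ 2)) * Real.exp (-(1 / (4 * t)))) (convex_Ici 1) ?_ ?_ ?_
    · exact hcont.mul (Real.continuous_exp.comp_continuousOn hcont2.neg)
    · intro x hx
      rw [interior_Ici, Set.mem_Ioi] at hx
      have hx0 : 0 < x := by linarith
      refine ((hasDerivAt_besselEnergy hx0).mul
        (hexp x hx0.ne').fun_neg.exp).hasDerivWithinAt.congr_deriv ?_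
      ring
    · intro x hx
      rw [interior_Ici, Set.mem_Ioi] at hx
      have := (abs_le.1 (abs_besselEnergy'_le (by linarith : 0 < x))).1
      exact mul_nonneg (by linarith) (Real.exp_pos _).le
  have h1 := hanti (Set.mem_Ici.2 le_rfl) (Set.mem_Ici.2 ht) ht
  have h2 := hmono (Set.mem_Ici.2 le_rfl) (Set.mem_Ici.2 ht) ht
  simp only [mul_one] at h1 h2
  have hE := besselJ_energy_le (zero_le_one' ℝ)
  have hJ1 := one_sub_le_besselJ (zero_le_one' ℝ)
  -- `J₀(1) ≥ 3 / 4` by the parabola bound.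
  have hlow : 9 / 16 ≤ besselEnergy 1 := by
    unfold besselEnergy
    nlinarith [sq_nonneg (besselJ' 1 + besselJ 1 / (2 * 1))]
  have hup : besselEnergy 1 ≤ 2 := by
    unfold besselEnergy
    nlinarith [sq_nonneg (besselJ' 1 - besselJ 1), sq_nonneg (besselJ' 1)]
  have hexp4 : Real.exp (1 / 4) ≤ 2 := by
    have : Real.exp (1 / 4) ≤ 1 / (1 - 1 / 4) := by
      have := Real.add_one_le_exp (-(1 / 4 : ℝ))
      rw [Real.exp_neg] at this
      rw [le_div_iff₀ (by norm_num)]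
      have hp := Real.exp_pos (1 / 4 : ℝ)
      have := mul_le_mul_of_nonneg_left this hp.le
      rw [mul_inv_cancel₀ hp.ne'] at this
      linarith
    norm_num at this ⊢; linarith
  have hexpm4 : 3 / 4 ≤ Real.exp (-(1 / 4)) := by
    linarith [Real.add_one_le_exp (-(1 / 4 : ℝ))]
  have hnn : 0 ≤ besselEnergy t := by unfold besselEnergy; positivity
  have htpos : 0 < 1 / (4 * t) := by positivity
  have he1 : 1 ≤ Real.exp (1 / (4 * t)) := Real.one_le_exp htpos.le
  have he2 : Real.exp (-(1 / (4 * t))) ≤ 1 := Real.exp_le_one_iff.2 (by linarith)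
  constructor <;> nlinarith

theorem mul_besselJ_sq_le {t : ℝ} (ht : 0 ≤ t) : t * besselJ t ^ 2 ≤ 4 := by
  rcases le_total 1 t with h | h
  · have := (besselEnergy_mem h).2
    unfold besselEnergy at this
    have h2 : 0 ≤ t * (besselJ' t + besselJ t / (2 * t)) ^ 2 := by positivity
    linarith
  · nlinarith [besselJ_energy_le ht, sq_nonneg (besselJ' t), sq_nonneg (besselJ t)]

/-- Interpolation between the bounds `|J₀| ≤ 1` and `t J₀(t)² ≤ 4`. -/
theorem mul_besselJ_pow_four_le {t : ℝ} (ht : 0 ≤ t) : t * besselJ t ^ 4 ≤ 4 := by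
  have h1 : besselJ t ^ 2 ≤ 1 := by nlinarith [besselJ_energy_le ht, sq_nonneg (besselJ' t)]
  have h2 := mul_besselJ_sq_le ht
  nlinarith [sq_nonneg (besselJ t), mul_nonneg ht (sq_nonneg (besselJ t))]

theorem mul_besselJ'_sq_le {t : ℝ} (ht : 1 ≤ t) : t * besselJ' t ^ 2 ≤ 10 := by
  have ht0 : 0 < t := by linarith
  have h := (besselEnergy_mem ht).2
  unfold besselEnergy at h
  set x := besselJ' t + besselJ t / (2 * t) with hx
  have h2 := mul_besselJ_sq_le ht0.le
  have h3 : besselJ' t = x - besselJ t / (2 * t) := by rw [hx]; ring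
  have h4 : t * (besselJ t / (2 * t)) ^ 2 ≤ 1 := by
    have : t * (besselJ t / (2 * t)) ^ 2 = besselJ t ^ 2 / (4 * t) := by field_simp; ring
    rw [this, div_le_one (by positivity)]
    nlinarith [besselJ_energy_le ht0.le, sq_nonneg (besselJ' t)]
  have h5 : t * besselJ' t ^ 2 ≤ 2 * (t * x ^ 2) + 2 * (t * (besselJ t / (2 * t)) ^ 2) := by
    rw [h3]
    nlinarith [mul_nonneg ht0.le (sq_nonneg (x + besselJ t / (2 * t)))]
  have h6 : 0 ≤ t * besselJ t ^ 2 := by positivity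
  linarith

/-! ### Zeros of `J₀`: slope, gaps and existence -/

theorem two_le_of_besselJ_eq_zero {z : ℝ} (hz : 0 ≤ z) (h : besselJ z = 0) : 2 ≤ z := by
  have := one_sub_le_besselJ hz
  rw [h] at this
  nlinarith

theorem one_fourth_le_of_besselJ_eq_zero {z : ℝ} (hz : 0 ≤ z) (h : besselJ z = 0) :
    1 / 4 ≤ z * besselJ' z ^ 2 := by
  have h2 := two_le_of_besselJ_eq_zero hz h
  have := (besselEnergy_mem (by linarith : 1 ≤ z)).1
  simpa [besselEnergy, h] using this

/-- By Rolle, `J₀'` vanishes at some `ξ` between the zeros. At `a` the slope is at least of order `a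
^ (-1/2)`, while `J₀''` is at most of that order beyond `a`, so `J₀'` needs a fixed length to reach
0: `(ξ - a) ^ 2 ≥ 1 / 112`. -/
theorem besselJ_zeros_gap {a b : ℝ} (ha : 0 < a) (hab : a < b) (hJa : besselJ a = 0)
    (hJb : besselJ b = 0) : a + 1 / 11 ≤ b := by
  have ha2 := two_le_of_besselJ_eq_zero ha.le hJa
  obtain ⟨ξ, hξ, hDξ⟩ := exists_hasDerivAt_eq_zero (f' := besselJ') hab
    continuous_besselJ.continuousOn (by rw [hJa, hJb]) fun x _ => hasDerivAt_besselJ x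
  have hξa : 0 < ξ - a := by linarith [hξ.1]
  obtain ⟨η, hη, hDη⟩ := exists_hasDerivAt_eq_slope besselJ'
    (fun t => -besselJ' t / t - besselJ t) hξ.1 continuous_besselJ'.continuousOn
    fun x hx => hasDerivAt_besselJ' (show x ≠ 0 by linarith [hx.1])
  have hη0 : 0 < η := by linarith [hη.1]
  have hη1 : 1 ≤ η := by linarith [hη.1]
  rw [hDξ, zero_sub, eq_div_iff hξa.ne'] at hDη
  have h1 := one_fourth_le_of_besselJ_eq_zero ha.le hJa
  have h2 := mul_besselJ'_sq_le hη1
  have h3 := mul_besselJ_sq_le hη0.le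
  have h4 : η * (-besselJ' η / η - besselJ η) ^ 2 ≤ 28 := by
    have h5 : η * (besselJ' η / η) ^ 2 ≤ 10 := by
      have : η * (besselJ' η / η) ^ 2 = η * besselJ' η ^ 2 / η ^ 2 := by field_simp
      rw [this, div_le_iff₀ (by positivity)]
      nlinarith
    have h6 : η * (-besselJ' η / η - besselJ η) ^ 2 ≤
        2 * (η * (besselJ' η / η) ^ 2) + 2 * (η * besselJ η ^ 2) := by
      rw [neg_div]
      nlinarith [mul_nonneg hη0.le (sq_nonneg (besselJ' η / η - besselJ η))]
    linarith
  have h7 : besselJ' a ^ 2 = (-besselJ' η / η - besselJ η) ^ 2 * (ξ - a) ^ 2 := by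
    rw [← mul_pow, hDη]; ring
  have h8 : a * (-besselJ' η / η - besselJ η) ^ 2 ≤ 28 :=
    le_trans (mul_le_mul_of_nonneg_right hη.1.le (sq_nonneg _)) h4
  have h9 : 1 / 4 ≤ 28 * (ξ - a) ^ 2 := by
    calc _ ≤ a * besselJ' a ^ 2 := h1
      _ = (a * (-besselJ' η / η - besselJ η) ^ 2) * (ξ - a) ^ 2 := by rw [h7]; ring
      _ ≤ _ := by gcongr
  have h10 : 1 / 11 ≤ ξ - a := by nlinarith
  linarith [hξ.2]

/-- `s J₀` cannot be positive on a half-line. -/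
theorem not_forall_pos_mul_besselJ {s a : ℝ} (hs : |s| = 1) (ha : 0 < a)
    (h : ∀ t, a ≤ t → 0 < s * besselJ t) : False := by
  have hle : ∀ t, 0 ≤ t → s * besselJ t ≤ 1 := fun t ht => by
    refine (le_abs_self _).trans ?_
    rw [abs_mul, hs, one_mul]
    exact abs_besselJ_le_one ht
  have hcJ := continuous_besselJ
  have hcJ' := continuous_besselJ'
  -- If `s t J₀'` is negative once, it stays below `-c` because its derivative is `-t s J₀ < 0`;
  -- then `s J₀` decreases at least like `-c log t`.
  by_cases hneg : ∃ b, a ≤ b ∧ s * (b * besselJ' b) < 0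
  · obtain ⟨b, hab, hb⟩ := hneg
    have hb0 : 0 < b := by linarith
    set c := -(s * (b * besselJ' b)) with hc
    have hc0 : 0 < c := by linarith
    have hF : ∀ t, b ≤ t → s * (t * besselJ' t) ≤ -c := by
      have : AntitoneOn (fun t => s * (t * besselJ' t)) (Set.Ici b) := by
        refine antitoneOn_of_hasDerivWithinAt_nonpos (f' := fun t => s * -(t * besselJ t))
          (convex_Ici b) (by fun_prop)
          (fun x _ => ((hasDerivAt_mul_besselJ' x).const_mul s).hasDerivWithinAt) ?_
        intro x hx
        rw [interior_Ici, Set.mem_Ioi] at hx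
        have h1 : 0 < x * (s * besselJ x) := mul_pos (by linarith) (h x (by linarith))
        nlinarith
      intro t ht
      have := this (Set.mem_Ici.2 le_rfl) (Set.mem_Ici.2 ht) ht
      simp only at this
      linarith
    have hlog : AntitoneOn (fun t => s * besselJ t + c * Real.log t) (Set.Ici b) := by
      refine antitoneOn_of_hasDerivWithinAt_nonpos (f' := fun t => s * besselJ' t + c * t⁻¹)
        (convex_Ici b) ?_ ?_ ?_
      · refine ContinuousOn.add (by fun_prop) (continuousOn_const.mul ?_)
        exact Real.continuousOn_log.mono fun x hx => by
          simp only [Set.mem_Ici] at hx; simp; linarith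
      · intro x hx
        rw [interior_Ici, Set.mem_Ioi] at hx
        exact (((hasDerivAt_besselJ x).const_mul s).add
          ((Real.hasDerivAt_log (by linarith)).const_mul c)).hasDerivWithinAt
      · intro x hx
        rw [interior_Ici, Set.mem_Ioi] at hx
        have hx0 : 0 < x := by linarith
        have := hF x hx.le
        have h2 : s * besselJ' x + c * x⁻¹ = (s * (x * besselJ' x) + c) / x := by field_simp
        rw [h2]
        exact div_nonpos_of_nonpos_of_nonneg (by linarith) hx0.le
    -- Over this range `c log t` gains exactly 1, which exhausts the bound `s J₀(b) ≤ 1`.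
    have hle1 : b ≤ b * Real.exp (1 / c) := by
      nlinarith [Real.one_le_exp (by positivity : 0 ≤ 1 / c)]
    have h1 := hlog (Set.mem_Ici.2 le_rfl) (Set.mem_Ici.2 hle1) hle1
    simp only at h1
    rw [Real.log_mul hb0.ne' (Real.exp_pos _).ne', Real.log_exp, mul_add,
      mul_one_div_cancel hc0.ne'] at h1
    have h2 := h (b * Real.exp (1 / c)) (by linarith)
    have h3 := hle b hb0.le
    linarith
  -- Otherwise `s J₀` is nondecreasing, hence at least `η > 0`, so `s t J₀'` has derivative at most
  -- `-η t` and must become negative.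
  · push Not at hneg
    have hJ : ∀ t, a ≤ t → s * besselJ a ≤ s * besselJ t := by
      have : MonotoneOn (fun t => s * besselJ t) (Set.Ici a) := by
        refine monotoneOn_of_hasDerivWithinAt_nonneg (f' := fun t => s * besselJ' t)
          (convex_Ici a) (by fun_prop)
          (fun x _ => ((hasDerivAt_besselJ x).const_mul s).hasDerivWithinAt) ?_
        intro x hx
        rw [interior_Ici, Set.mem_Ioi] at hx
        have h1 := hneg x hx.le
        by_contra! hc
        nlinarith
      intro t ht
      exact this (Set.mem_Ici.2 le_rfl) (Set.mem_Ici.2 ht) ht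
    set η := s * besselJ a with hη
    have hη0 : 0 < η := h a le_rfl
    have hanti : AntitoneOn (fun t => s * (t * besselJ' t) + η * (t ^ 2 / 2)) (Set.Ici a) := by
      refine antitoneOn_of_hasDerivWithinAt_nonpos
        (f' := fun t => s * -(t * besselJ t) + η * t) (convex_Ici a) (by fun_prop) ?_ ?_
      · intro x hx
        refine (((hasDerivAt_mul_besselJ' x).const_mul s).add
          (((hasDerivAt_pow 2 x).div_const 2).const_mul η)).hasDerivWithinAt.congr_deriv ?_
        simp
      · intro x hx
        rw [interior_Ici, Set.mem_Ioi] at hx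
        have := hJ x hx.le
        nlinarith
    set B := s * (a * besselJ' a) + η * (a ^ 2 / 2) with hB
    have hB0 : 0 ≤ B := add_nonneg (hneg a le_rfl) (by positivity)
    set t := a + 2 * B / η + 2 with ht
    have hat : a ≤ t := by
      have : 0 ≤ 2 * B / η := by positivity
      linarith
    have h1 := hanti (Set.mem_Ici.2 le_rfl) (Set.mem_Ici.2 hat) hat
    simp only at h1
    have h2 := hneg t hat
    have h3 : B < η * (t ^ 2 / 2) := by
      have e : η * (2 * B / η) = 2 * B := by field_simp
      have h4 : 0 ≤ 2 * B / η := by positivity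
      have h5 : 2 * B / η + 2 ≤ t := by linarith
      have h6 : 2 * B / η + 2 ≤ t ^ 2 := by nlinarith
      nlinarith
    linarith

theorem exists_besselJ_zero_gt {a : ℝ} (ha : 0 < a) : ∃ z, a < z ∧ besselJ z = 0 := by
  by_contra! hne
  have hpos : 0 < a + 1 := by linarith
  rcases lt_or_gt_of_ne (hne (a + 1) (by linarith)) with hs | hs
  · refine not_forall_pos_mul_besselJ (s := -1) (by simp) hpos fun t ht => ?_
    by_contra! hc
    have hct : 0 ≤ besselJ t := by linarith
    obtain ⟨z, hz, hz0⟩ := intermediate_value_Icc ht continuous_besselJ.continuousOn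
      (show (0 : ℝ) ∈ Set.Icc (besselJ (a + 1)) (besselJ t) from ⟨hs.le, hct⟩)
    exact hne z (by linarith [hz.1]) hz0
  · refine not_forall_pos_mul_besselJ (s := 1) (by simp) hpos fun t ht => ?_
    by_contra! hc
    have hct : besselJ t ≤ 0 := by linarith
    obtain ⟨z, hz, hz0⟩ := intermediate_value_Icc' ht continuous_besselJ.continuousOn
      (show (0 : ℝ) ∈ Set.Icc (besselJ t) (besselJ (a + 1)) from ⟨hct, hs.le⟩)
    exact hne z (by linarith [hz.1]) hz0

/-- The positive zeros of `J₀`. -/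
def besselZeros : Set ℝ := {z | 0 < z ∧ besselJ z = 0}

/-- An element closer than `δ` to the infimum must be the infimum, since a smaller element would lie
at least `δ` below it. This makes the recursive `sInf` in `radialFreq` select actual zeros. -/
theorem csInf_mem_of_gap {S : Set ℝ} {δ : ℝ} (hδ : 0 < δ) (hne : S.Nonempty) (hbdd : BddBelow S)
    (hgap : ∀ a ∈ S, ∀ b ∈ S, a < b → a + δ ≤ b) : sInf S ∈ S := by
  obtain ⟨a, haS, ha⟩ := exists_lt_of_csInf_lt hne (lt_add_of_pos_right (sInf S) hδ)
  have : a = sInf S := by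
    refine le_antisymm (le_csInf hne fun b hb => ?_) (csInf_le hbdd haS)
    by_contra! hba
    linarith [hgap b hb a haS hba, csInf_le hbdd hb]
  exact this ▸ haS

theorem besselZeros_gap : ∀ a ∈ besselZeros, ∀ b ∈ besselZeros, a < b → a + 1 / 11 ≤ b :=
  fun _ ha _ hb hab => besselJ_zeros_gap ha.1 hab ha.2 hb.2

theorem sInf_besselZeros_mem : sInf besselZeros ∈ besselZeros := by
  refine csInf_mem_of_gap (by norm_num) ?_ ⟨0, fun z hz => hz.1.le⟩ besselZeros_gap
  obtain ⟨z, hz, h0⟩ := exists_besselJ_zero_gt one_pos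
  exact ⟨z, by linarith, h0⟩

theorem sInf_besselZeros_inter_mem {a : ℝ} (ha : 0 < a) :
    sInf (besselZeros ∩ Set.Ioi a) ∈ besselZeros ∩ Set.Ioi a := by
  refine csInf_mem_of_gap (by norm_num) ?_ ⟨0, fun z hz => hz.1.1.le⟩
    fun x hx y hy => besselZeros_gap x hx.1 y hy.1
  obtain ⟨z, hz, h0⟩ := exists_besselJ_zero_gt ha
  exact ⟨z, ⟨by linarith, h0⟩, hz⟩

/-! ### Radial Dirichlet eigenfunctions are multiples of `J₀(z |x|)` -/

open Filter Topology in
-- Reduces the Hessian to one-variable derivatives along a line, so that Laplacians of radial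
-- functions become explicit computations.
theorem iteratedFDeriv_two_apply_eq_of_hasDerivAt {E : Type*} [NormedAddCommGroup E]
    [NormedSpace ℝ E] {f : E → ℝ} {x v : E} {h : ℝ → ℝ} {c : ℝ} (hf : ContDiffAt ℝ 2 f x)
    (h1 : ∀ᶠ t in 𝓝 (0 : ℝ), HasDerivAt (fun t : ℝ => f (x + t • v)) (h t) t)
    (h2 : HasDerivAt h c 0) : iteratedFDeriv ℝ 2 f x ![v, v] = c := by
  rw [iteratedFDeriv_two_apply]
  simp only [Matrix.cons_val_zero, Matrix.cons_val_one]
  have hline : ∀ t : ℝ, HasDerivAt (fun t : ℝ => x + t • v) v t := fun t => by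
    simpa using ((hasDerivAt_id t).smul_const v).const_add x
  have hd2 : DifferentiableAt ℝ (fderiv ℝ f) x :=
    (hf.fderiv_right (m := 1) (by norm_num)).differentiableAt (by norm_num)
  have hcont : Tendsto (fun t : ℝ => x + t • v) (𝓝 0) (𝓝 x) := by
    have := (hline 0).continuousAt.tendsto
    simpa using this
  have hd1 : ∀ᶠ t in 𝓝 (0 : ℝ), DifferentiableAt ℝ f (x + t • v) := by
    have : ∀ᶠ y in 𝓝 x, ContDiffAt ℝ 2 f y := hf.eventually (by simp)
    exact (hcont.eventually this).mono fun t ht => ht.differentiableAt (by norm_num)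
  have heq : (fun t : ℝ => fderiv ℝ f (x + t • v) v) =ᶠ[𝓝 0] h := by
    filter_upwards [h1, hd1] with t ht1 ht2
    exact (ht2.hasFDerivAt.comp_hasDerivAt t (hline t)).unique ht1
  have hd2' : HasFDerivAt (fderiv ℝ f) (fderiv ℝ (fderiv ℝ f) x) (x + (0 : ℝ) • v) := by
    simpa using hd2.hasFDerivAt
  have h3 := hd2'.comp_hasDerivAt 0 (hline 0)
  have h4 : HasDerivAt (fun t : ℝ => fderiv ℝ f (x + t • v) v) (fderiv ℝ (fderiv ℝ f) x v v) 0 := by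
    simpa using h3.clm_apply (hasDerivAt_const (0 : ℝ) v)
  exact (h4.congr_of_eventuallyEq heq.symm).unique h2

theorem laplacian_eq_of_hasDerivAt {f : Plane → ℝ} {x : Plane} {h : Fin 2 → ℝ → ℝ} {c : Fin 2 → ℝ}
    (hf : ContDiffAt ℝ 2 f x)
    (h1 : ∀ i, ∀ᶠ t in nhds (0 : ℝ), HasDerivAt
      (fun t : ℝ => f (x + t • EuclideanSpace.basisFun (Fin 2) ℝ i)) (h i t) t)
    (h2 : ∀ i, HasDerivAt (h i) (c i) 0) : Laplacian.laplacian f x = c 0 + c 1 := by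
  rw [InnerProductSpace.laplacian_eq_iteratedFDeriv_orthonormalBasis f
    (EuclideanSpace.basisFun (Fin 2) ℝ)]
  simp only [Fin.sum_univ_two]
  rw [iteratedFDeriv_two_apply_eq_of_hasDerivAt hf (h1 0) (h2 0),
    iteratedFDeriv_two_apply_eq_of_hasDerivAt hf (h1 1) (h2 1)]

theorem norm_add_smul_basisFun_sq (x : Plane) (i : Fin 2) (t : ℝ) :
    ‖x + t • EuclideanSpace.basisFun (Fin 2) ℝ i‖ ^ 2 = ‖x‖ ^ 2 + 2 * t * x i + t ^ 2 := by
  rw [EuclideanSpace.norm_sq_eq, EuclideanSpace.norm_sq_eq]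
  fin_cases i <;> simp [Fin.sum_univ_two] <;> ring

/-- The radial solution of `-Δ f = z² f` on the plane. -/
noncomputable def radialBessel (z : ℝ) (x : Plane) : ℝ := besselJ (z * ‖x‖)

/-- `J₀` is even: a smooth function of `‖x‖ ^ 2` has no singularity at the origin. -/
theorem contDiff_radialBessel (z : ℝ) : ContDiff ℝ 2 (radialBessel z) := by
  have : radialBessel z = fun x : Plane => besselSeries 0 (z ^ 2 * ‖x‖ ^ 2) := by
    ext x; simp [radialBessel, besselJ, mul_pow]
  rw [this]
  exact (contDiff_besselSeries 2 0).comp (contDiff_const.mul (contDiff_norm_sq ℝ))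

/-- In `s = z ^ 2 ‖x‖ ^ 2`, the Laplacian of `B(s)` is `4 z ^ 2 (s B'' + B')`, and the series form
of Bessel's equation turns it into `-z ^ 2 B`. Unlike the polar form, this covers the origin. -/
theorem laplacian_radialBessel (z : ℝ) (x : Plane) :
    Laplacian.laplacian (radialBessel z) x = -(z ^ 2 * radialBessel z x) := by
  set S : Fin 2 → ℝ → ℝ := fun i t => z ^ 2 * (‖x‖ ^ 2 + 2 * t * x i + t ^ 2) with hS
  have hSd : ∀ i t, HasDerivAt (S i) (z ^ 2 * (2 * x i + 2 * t)) t := fun i t => by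
    have := ((((hasDerivAt_id t).const_mul 2).mul_const (x i)).const_add (‖x‖ ^ 2)).add
      (hasDerivAt_pow 2 t) |>.const_mul (z ^ 2)
    refine this.congr_deriv ?_
    simp
  have hf : ∀ i t, radialBessel z (x + t • EuclideanSpace.basisFun (Fin 2) ℝ i) =
      besselSeries 0 (S i t) := fun i t => by
    simp only [radialBessel, besselJ, mul_pow, norm_add_smul_basisFun_sq, hS]
  have hS0 : ∀ i, S i 0 = z ^ 2 * ‖x‖ ^ 2 := fun i => by simp [hS]
  rw [laplacian_eq_of_hasDerivAt (contDiff_radialBessel z).contDiffAt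
    (h := fun i t => besselSeries 1 (S i t) * (z ^ 2 * (2 * x i + 2 * t)))
    (c := fun i => besselSeries 2 (S i 0) * (z ^ 2 * (2 * x i)) * (z ^ 2 * (2 * x i)) +
      besselSeries 1 (S i 0) * (z ^ 2 * 2))]
  · rw [hS0, hS0]
    have := besselSeries_ode (z ^ 2 * ‖x‖ ^ 2)
    have hn : ‖x‖ ^ 2 = x 0 ^ 2 + x 1 ^ 2 := by
      rw [EuclideanSpace.norm_sq_eq, Fin.sum_univ_two]; simp
    have hr : radialBessel z x = besselSeries 0 (z ^ 2 * ‖x‖ ^ 2) := by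
      simp [radialBessel, besselJ, mul_pow]
    rw [hr]
    set s := z ^ 2 * ‖x‖ ^ 2 with hs
    have hs' : s = z ^ 2 * (x 0 ^ 2 + x 1 ^ 2) := by rw [hs, hn]
    linear_combination (4 * z ^ 2) * this - 4 * z ^ 2 * besselSeries 2 s * hs'
  · intro i
    refine Filter.Eventually.of_forall fun t => ?_
    simp_rw [hf]
    exact (hasDerivAt_besselSeries 0 (S i t)).comp t (hSd i t)
  · intro i
    have h1 := (hasDerivAt_besselSeries 1 (S i 0)).comp 0 (hSd i 0)
    have h2 : HasDerivAt (fun t : ℝ => z ^ 2 * (2 * x i + 2 * t)) (z ^ 2 * 2) 0 := by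
      have := (((hasDerivAt_id (0 : ℝ)).const_mul 2).const_add (2 * x i)).const_mul (z ^ 2)
      simpa using this
    refine (h1.mul h2).congr_deriv ?_
    simp

theorem isRadialDirichletEigenfunction_const_mul_radialBessel {z c : ℝ} (hz : besselJ z = 0)
    (hc : c ≠ 0) : IsRadialDirichletEigenfunction z fun x => c * radialBessel z x where
  continuousOn := ((contDiff_radialBessel z).continuous.const_mul c).continuousOn
  contDiffOn := (contDiff_const.mul (contDiff_radialBessel z)).contDiffOn
  radial x _ y _ hxy := by simp [radialBessel, hxy]
  eigen x _ := by
    have := InnerProductSpace.laplacian_smul c (contDiff_radialBessel z).contDiffAt (x := x)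
    have h2 : (fun x => c * radialBessel z x) = c • radialBessel z := rfl
    rw [h2, this, laplacian_radialBessel]
    simp only [smul_eq_mul]; ring
  boundary x hx := by
    rw [mem_sphere_zero_iff_norm] at hx
    simp [radialBessel, hx, hz]
  nontrivial := ⟨0, by simp [disc], by simp [radialBessel, besselJ_zero, hc]⟩

/-- The unit vector `(1, 0)`. -/
noncomputable def axis : Plane := EuclideanSpace.basisFun (Fin 2) ℝ 0

theorem norm_axis : ‖axis‖ = 1 := (EuclideanSpace.basisFun (Fin 2) ℝ).norm_eq_one 0

theorem norm_smul_axis (t : ℝ) : ‖t • axis‖ = |t| := by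
  rw [norm_smul, norm_axis, mul_one, Real.norm_eq_abs]

theorem smul_axis_mem_disc {t : ℝ} (ht : |t| < 1) : t • axis ∈ disc := by
  rw [disc, mem_ball_zero_iff, norm_smul_axis]; exact ht

section Profile

variable {f : Plane → ℝ}

open Filter Topology

theorem contDiffAt_profile (hf : ContDiffOn ℝ 2 f disc) {t : ℝ} (ht : |t| < 1) :
    ContDiffAt ℝ 2 (fun t : ℝ => f (t • axis)) t :=
  (hf.contDiffAt (Metric.isOpen_ball.mem_nhds (smul_axis_mem_disc ht))).comp t
    (contDiff_id.smul contDiff_const).contDiffAt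

theorem hasDerivAt_deriv_of_contDiffAt {F : ℝ → ℝ} {t : ℝ} (hF : ContDiffAt ℝ 2 F t) :
    HasDerivAt (deriv F) (deriv (deriv F) t) t := by
  have h1 : ContDiffAt ℝ 1 (fun s => fderiv ℝ F s 1) t :=
    (hF.fderiv_right (m := 1) (by norm_num)).clm_apply contDiffAt_const
  exact (h1.differentiableAt (by norm_num)).hasDerivAt

/-- The polar form of the Laplacian of a radial function. -/
theorem laplacian_of_radial (hf : ContDiffOn ℝ 2 f disc)
    (hrad : ∀ x ∈ disc, ∀ y ∈ disc, ‖x‖ = ‖y‖ → f x = f y) {t : ℝ} (ht0 : 0 < t) (ht1 : t < 1) :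
    Laplacian.laplacian f (t • axis) = deriv (deriv fun t : ℝ => f (t • axis)) t +
      deriv (fun t : ℝ => f (t • axis)) t / t := by
  set F : ℝ → ℝ := fun t => f (t • axis) with hF
  have habs : |t| < 1 := by rwa [abs_of_pos ht0]
  have hFd : ∀ s : ℝ, |s| < 1 → HasDerivAt F (deriv F s) s := fun s hs =>
    ((contDiffAt_profile hf hs).differentiableAt (by norm_num)).hasDerivAt
  have hF2 : HasDerivAt (deriv F) (deriv (deriv F) t) t :=
    hasDerivAt_deriv_of_contDiffAt (contDiffAt_profile hf habs)
  have hsq : ∀ s : ℝ, HasDerivAt (fun s : ℝ => √(t ^ 2 + s ^ 2)) (s / √(t ^ 2 + s ^ 2)) s := by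
    intro s
    have := ((hasDerivAt_pow 2 s).const_add (t ^ 2)).sqrt (by positivity)
    refine this.congr_deriv ?_
    field_simp; simp
  have hcont : Tendsto (fun s : ℝ => √(t ^ 2 + s ^ 2)) (𝓝 0) (𝓝 t) := by
    have := (hsq 0).continuousAt.tendsto
    simpa [Real.sqrt_sq ht0.le] using this
  have hlt : ∀ᶠ s in 𝓝 (0 : ℝ), √(t ^ 2 + s ^ 2) < 1 := hcont.eventually_lt_const ht1
  have hlt2 : ∀ᶠ s in 𝓝 (0 : ℝ), |t + s| < 1 := by
    have : Tendsto (fun s : ℝ => |t + s|) (𝓝 0) (𝓝 |t + 0|) := by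
      apply Continuous.tendsto; fun_prop
    rw [add_zero] at this
    exact this.eventually_lt_const habs
  -- In the axis direction `f` is its own profile `F`. In the orthogonal direction it is `F(√(t ^ 2
  -- + s ^ 2))`, whose second derivative at `s = 0` is `F'(t) / t`.
  rw [laplacian_eq_of_hasDerivAt (hf.contDiffAt (Metric.isOpen_ball.mem_nhds
      (smul_axis_mem_disc habs)))
    (h := ![fun s => deriv F (t + s),
      fun s => deriv F (√(t ^ 2 + s ^ 2)) * (s / √(t ^ 2 + s ^ 2))])
    (c := ![deriv (deriv F) t, deriv F t / t])]
  · simp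
  · rw [Fin.forall_fin_two]
    constructor
    · filter_upwards [hlt2] with s hs
      have h1 := (hFd (t + s) hs).comp s ((hasDerivAt_id s).const_add t)
      rw [mul_one] at h1
      refine h1.congr_of_eventuallyEq (Eventually.of_forall fun u => ?_)
      simp [hF, axis, add_smul]
    · filter_upwards [hlt.eventually_nhds] with s hs
      have h0 : √(t ^ 2 + s ^ 2) < 1 := hs.self_of_nhds
      have h1 := (hFd (√(t ^ 2 + s ^ 2))
        (by rwa [abs_of_nonneg (Real.sqrt_nonneg _)])).comp s (hsq s)
      refine h1.congr_of_eventuallyEq ?_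
      filter_upwards [hs] with u hu
      have hnorm : ‖t • axis + u • EuclideanSpace.basisFun (Fin 2) ℝ 1‖ = √(t ^ 2 + u ^ 2) := by
        rw [eq_comm, Real.sqrt_eq_iff_eq_sq (by positivity) (norm_nonneg _),
          norm_add_smul_basisFun_sq, norm_smul_axis, sq_abs]
        simp [axis]
      refine hrad _ ?_ _ (smul_axis_mem_disc ?_) ?_
      · rw [disc, mem_ball_zero_iff, hnorm]; exact hu
      · rwa [abs_of_nonneg (Real.sqrt_nonneg _)]
      · rw [hnorm, norm_smul_axis, abs_of_nonneg (Real.sqrt_nonneg _)]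
  · rw [Fin.forall_fin_two]
    constructor
    · have : HasDerivAt (fun s : ℝ => t + s) 1 0 := (hasDerivAt_id (0 : ℝ)).const_add t
      have h2 : HasDerivAt (deriv F) (deriv (deriv F) t) (t + 0) := by simpa using hF2
      exact (h2.comp 0 this).congr_deriv (mul_one _)
    · have e0 : √(t ^ 2 + 0 ^ 2) = t := by simp [Real.sqrt_sq ht0.le]
      have h2 : HasDerivAt (deriv F) (deriv (deriv F) t) (√(t ^ 2 + 0 ^ 2)) := by rw [e0]; exact hF2
      have h3 := h2.comp 0 (hsq 0)
      have h4 : HasDerivAt (fun s : ℝ => s / √(t ^ 2 + s ^ 2)) (1 / t) 0 := by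
        have := (hasDerivAt_id (0 : ℝ)).div (hsq 0) (by rw [e0]; exact ht0.ne')
        refine this.congr_deriv ?_
        rw [e0]; simp; field_simp
      refine (h3.mul h4).congr_deriv ?_
      simp [Real.sqrt_sq ht0.le]; ring

/-- The only regular solutions of Bessel's equation are the multiples of `J₀`. -/
theorem eq_mul_besselJ_of_ode {z : ℝ} (hz : 0 < z) {F F1 F2 : ℝ → ℝ}
    (hF : ∀ t, 0 ≤ t → t < 1 → HasDerivAt F (F1 t) t)
    (hF1 : ∀ t, 0 ≤ t → t < 1 → HasDerivAt F1 (F2 t) t) (h0 : F1 0 = 0)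
    (hode : ∀ t, 0 < t → t < 1 → F2 t + F1 t / t + z ^ 2 * F t = 0) {t : ℝ} (ht0 : 0 ≤ t)
    (ht1 : t < 1) : F t = F 0 * besselJ (z * t) := by
  set k : ℝ → ℝ := fun t => F t - F 0 * besselJ (z * t) with hk
  set k1 : ℝ → ℝ := fun t => F1 t - F 0 * (z * besselJ' (z * t)) with hk1
  have hzt : ∀ t : ℝ, HasDerivAt (fun t : ℝ => z * t) z t := fun t => by
    simpa using (hasDerivAt_id t).const_mul z
  have hkd : ∀ t, 0 ≤ t → t < 1 → HasDerivAt k (k1 t) t := fun t ht ht' => by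
    refine ((hF t ht ht').sub
      (((hasDerivAt_besselJ (z * t)).comp t (hzt t)).const_mul (F 0))).congr_deriv ?_
    simp only [hk1]; ring
  -- The difference `k` solves the same damped equation with zero initial data; its energy is
  -- nonincreasing and starts at 0.
  have hanti : AntitoneOn (fun t => k1 t ^ 2 + z ^ 2 * k t ^ 2) (Set.Ico 0 1) := by
    refine antitoneOn_of_hasDerivWithinAt_nonpos (f' := fun t => -2 * k1 t ^ 2 / t)
      (convex_Ico 0 1) ?_ ?_ ?_
    · intro x hx
      have h1 := (hkd x hx.1 hx.2).continuousAt
      have h2 : ContinuousAt k1 x := (hF1 x hx.1 hx.2).continuousAt.sub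
        (continuousAt_const.mul (continuousAt_const.mul
          (continuous_besselJ'.comp (continuous_const.mul continuous_id)).continuousAt))
      exact ((h2.pow 2).add (continuousAt_const.mul (h1.pow 2))).continuousWithinAt
    · intro x hx
      rw [interior_Ico] at hx
      have hx0 : z * x ≠ 0 := (mul_pos hz hx.1).ne'
      have hk1d : HasDerivAt k1 (-k1 x / x - z ^ 2 * k x) x := by
        refine ((hF1 x hx.1.le hx.2).sub ((((hasDerivAt_besselJ' hx0).comp x (hzt x)).const_mul
          z).const_mul (F 0))).congr_deriv ?_
        have h := hode x hx.1 hx.2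
        have hx' := hx.1.ne'
        simp only [hk, hk1]
        field_simp at h ⊢
        linear_combination h
      refine ((hk1d.pow 2).add
        (((hkd x hx.1.le hx.2).pow 2).const_mul (z ^ 2))).hasDerivWithinAt.congr_deriv ?_
      simp; ring
    · intro x hx
      rw [interior_Ico] at hx
      have : 0 ≤ k1 x ^ 2 / x := div_nonneg (sq_nonneg _) hx.1.le
      simp only [neg_mul, neg_div, mul_div_assoc]; linarith
  have := hanti (Set.mem_Ico.2 ⟨le_rfl, one_pos⟩) (Set.mem_Ico.2 ⟨ht0, ht1⟩) ht0
  simp only [hk1, hk, h0, mul_zero, besselJ'_zero, besselJ_zero, mul_one, sub_self] at this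
  have h2 : z ^ 2 * (F t - F 0 * besselJ (z * t)) ^ 2 ≤ 0 := by
    nlinarith [sq_nonneg (F1 t - F 0 * (z * besselJ' (z * t)))]
  have h3 : (F t - F 0 * besselJ (z * t)) ^ 2 ≤ 0 := by
    by_contra! hc
    have : 0 < z ^ 2 * (F t - F 0 * besselJ (z * t)) ^ 2 := by positivity
    linarith
  have h4 : F t - F 0 * besselJ (z * t) = 0 := by
    rw [← sq_eq_zero_iff]; exact le_antisymm h3 (sq_nonneg _)
  linarith

theorem IsRadialDirichletEigenfunction.eq_mul_radialBessel {z : ℝ} (hz : 0 < z)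
    (h : IsRadialDirichletEigenfunction z f) {x : Plane} (hx : x ∈ disc) :
    f x = f 0 * radialBessel z x := by
  set F : ℝ → ℝ := fun t => f (t • axis) with hF
  have habs : ∀ t : ℝ, 0 ≤ t → t < 1 → |t| < 1 := fun t h1 h2 => by rwa [abs_of_nonneg h1]
  have hxn : ‖x‖ < 1 := by simpa [disc] using hx
  have hxF : f x = F ‖x‖ := h.radial _ hx _ (smul_axis_mem_disc (by simpa using hxn))
    (by rw [norm_smul_axis, abs_norm])
  have h0 : f 0 = F 0 := by simp [hF]
  rw [hxF, h0, radialBessel]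
  refine eq_mul_besselJ_of_ode hz (F1 := deriv F) (F2 := deriv (deriv F)) ?_ ?_ ?_ ?_
    (norm_nonneg x) hxn
  · intro t ht ht1
    exact ((contDiffAt_profile h.contDiffOn (habs t ht ht1)).differentiableAt
      (by norm_num)).hasDerivAt
  · intro t ht ht1
    exact hasDerivAt_deriv_of_contDiffAt (contDiffAt_profile h.contDiffOn (habs t ht ht1))
  -- Radiality makes the profile even, which gives the missing initial condition `F'(0) = 0`.
  · have heven : (fun t => F (-t)) =ᶠ[𝓝 0] F := by
      have : ∀ᶠ t in 𝓝 (0 : ℝ), |t| < 1 := by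
        have h1 : Tendsto (fun t : ℝ => |t|) (𝓝 0) (𝓝 |0|) := continuous_abs.tendsto 0
        rw [abs_zero] at h1
        exact h1.eventually_lt_const one_pos
      filter_upwards [this] with t ht
      exact h.radial _ (smul_axis_mem_disc (by rwa [abs_neg])) _ (smul_axis_mem_disc ht)
        (by rw [norm_smul_axis, norm_smul_axis, abs_neg])
    have h1 := heven.deriv_eq
    rw [deriv_comp_neg, neg_zero] at h1
    linarith
  · intro t ht ht1
    have h1 := h.eigen _ (smul_axis_mem_disc (habs t ht.le ht1))
    rw [laplacian_of_radial h.contDiffOn h.radial ht ht1] at h1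
    simp only [← hF] at h1
    have : F t = f (t • axis) := rfl
    rw [this]; linarith

theorem IsRadialDirichletEigenfunction.besselJ_eq_zero {z : ℝ} (hz : 0 < z)
    (h : IsRadialDirichletEigenfunction z f) : besselJ z = 0 := by
  have hf0 : f 0 ≠ 0 := by
    obtain ⟨x, hx, hne⟩ := h.nontrivial
    intro hc
    rw [h.eq_mul_radialBessel hz hx, hc, zero_mul] at hne
    exact hne rfl
  have hsub : ∀ t : ℝ, t ∈ Set.Icc 0 1 → t • axis ∈ Metric.closedBall (0 : Plane) 1 := by
    intro t ht
    rw [mem_closedBall_zero_iff, norm_smul_axis, abs_of_nonneg ht.1]; exact ht.2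
  have hc1 : ContinuousOn (fun t : ℝ => f (t • axis)) (Set.Icc 0 1) :=
    h.continuousOn.comp (by fun_prop) hsub
  have hc2 : ContinuousOn (fun t : ℝ => f 0 * besselJ (z * t)) (Set.Icc 0 1) :=
    (continuous_const.mul (continuous_besselJ.comp (by fun_prop))).continuousOn
  have heq : Set.EqOn (fun t : ℝ => f (t • axis)) (fun t : ℝ => f 0 * besselJ (z * t))
      (Set.Ico 0 1) := by
    intro t ht
    have := h.eq_mul_radialBessel hz (smul_axis_mem_disc (t := t)
      (by rw [abs_of_nonneg ht.1]; exact ht.2))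
    simp only [this, radialBessel, norm_smul_axis, abs_of_nonneg ht.1]
  -- The identity is known only inside the disc; continuity up to the boundary carries it to radius
  -- 1, where `f` vanishes.
  have h1 := heq.of_subset_closure hc1 hc2 Set.Ico_subset_Icc_self
    (by rw [closure_Ico zero_ne_one]) (Set.mem_Icc.2 ⟨zero_le_one, le_rfl⟩)
  simp only [one_smul, mul_one] at h1
  rw [h.boundary axis (by simp [norm_axis])] at h1
  exact (mul_eq_zero.1 h1.symm).resolve_left hf0

end Profile

/-! ### Enumeration of the frequencies -/

theorem radialFrequencies_eq : radialFrequencies = besselZeros := by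
  ext z
  constructor
  · rintro ⟨hz, f, hf⟩
    exact ⟨hz, hf.besselJ_eq_zero hz⟩
  · rintro ⟨hz, hJ⟩
    exact ⟨hz, _, isRadialDirichletEigenfunction_const_mul_radialBessel hJ one_ne_zero⟩

theorem radialFreq_mem (n : ℕ) : radialFreq n ∈ besselZeros := by
  induction n with
  | zero => rw [radialFreq, radialFrequencies_eq]; exact sInf_besselZeros_mem
  | succ n ih =>
    rw [radialFreq, radialFrequencies_eq]; exact (sInf_besselZeros_inter_mem ih.1).1

theorem radialFreq_pos (n : ℕ) : 0 < radialFreq n := (radialFreq_mem n).1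

theorem besselJ_radialFreq (n : ℕ) : besselJ (radialFreq n) = 0 := (radialFreq_mem n).2

theorem radialFreq_lt_succ (n : ℕ) : radialFreq n < radialFreq (n + 1) := by
  have := (sInf_besselZeros_inter_mem (radialFreq_pos n)).2
  rwa [← radialFrequencies_eq] at this

theorem strictMono_radialFreq : StrictMono radialFreq :=
  strictMono_nat_of_lt_succ radialFreq_lt_succ

theorem le_radialFreq (n : ℕ) : ((n : ℝ) + 1) / 11 ≤ radialFreq n := by
  induction n with
  | zero =>
    have := two_le_of_besselJ_eq_zero (radialFreq_pos 0).le (besselJ_radialFreq 0)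
    norm_num; linarith
  | succ n ih =>
    have := besselZeros_gap _ (radialFreq_mem n) _ (radialFreq_mem (n + 1)) (radialFreq_lt_succ n)
    push_cast; linarith

/-! ### Polar integration, orthogonality and normalization of the modes -/

instance instIsFiniteMeasureDiscMeasure : IsFiniteMeasure discMeasure :=
  ⟨by rw [discMeasure, Measure.restrict_apply_univ]; exact measure_ball_lt_top⟩

theorem volume_real_ball_plane : volume.real (Metric.ball (0 : Plane) 1) = Real.pi := by
  simp [Measure.real, EuclideanSpace.volume_ball_fin_two, Real.pi_pos.le]

/-- Integration in polar coordinates over the disc. -/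
theorem integral_discMeasure_norm (F : ℝ → ℝ) :
    ∫ x, F ‖x‖ ∂discMeasure = 2 * Real.pi * ∫ r in (0 : ℝ)..1, r * F r := by
  have h := integral_fun_norm_addHaar (volume : Measure Plane) ((Set.Iio (1 : ℝ)).indicator F)
  have h1 : ∫ x : Plane, (Set.Iio (1 : ℝ)).indicator F ‖x‖ = ∫ x, F ‖x‖ ∂discMeasure := by
    rw [discMeasure, disc, ← integral_indicator measurableSet_ball]
    congr 1
    ext x
    simp [Set.indicator]
  rw [h1] at h
  rw [h, volume_real_ball_plane, finrank_euclideanSpace_fin, nsmul_eq_mul, smul_eq_mul,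
    intervalIntegral.integral_of_le zero_le_one, integral_Ioc_eq_integral_Ioo]
  have h2 : ∀ y : ℝ, y ^ (2 - 1) • (Set.Iio (1 : ℝ)).indicator F y =
      (Set.Iio (1 : ℝ)).indicator (fun y => y * F y) y := by
    intro y
    by_cases hy : y < 1 <;> simp [hy]
  simp_rw [h2]
  rw [setIntegral_indicator measurableSet_Iio, Set.Ioi_inter_Iio]
  push_cast; ring

/-- The Jacobian `r` cancels the singularity. This weight later absorbs the blow-up of the modes at
the centre. -/
theorem integrable_discMeasure_norm_inv :
    Integrable (fun x : Plane => ‖x‖⁻¹) discMeasure := by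
  have := (integrableOn_fun_norm_addHaar (E := Plane) (volume : Measure Plane)
    (f := fun r : ℝ => r⁻¹) (r := 1)).2 ?_
  · exact this
  · refine (integrableOn_congr_fun (f := fun _ : ℝ => (1 : ℝ)) ?_ measurableSet_Ioo).1
      (by simp [integrableOn_const_iff])
    intro y hy
    have : y ≠ 0 := hy.1.ne'
    simp [this]

theorem lintegral_discMeasure_norm_inv :
    ∫⁻ x : Plane, ENNReal.ofReal ‖x‖⁻¹ ∂discMeasure = ENNReal.ofReal (2 * Real.pi) := by
  rw [← ofReal_integral_eq_lintegral_ofReal integrable_discMeasure_norm_inv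
    (Filter.Eventually.of_forall fun x => by positivity),
    integral_discMeasure_norm (fun r => r⁻¹)]
  congr 1
  have : ∫ r in (0 : ℝ)..1, r * r⁻¹ = ∫ r in (0 : ℝ)..1, (1 : ℝ) := by
    refine intervalIntegral.integral_congr_ae ?_
    refine Filter.Eventually.of_forall fun x hx => ?_
    rw [Set.uIoc_of_le zero_le_one] at hx
    exact mul_inv_cancel₀ hx.1.ne'
  rw [this]; simp

theorem integrable_discMeasure_of_continuous {F : ℝ → ℝ} (hF : Continuous F) :
    Integrable (fun x : Plane => F ‖x‖) discMeasure := by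
  have : IntegrableOn (fun x : Plane => F ‖x‖) (Metric.closedBall 0 1) volume :=
    (hF.comp continuous_norm).continuousOn.integrableOn_compact (isCompact_closedBall 0 1)
  exact this.mono_set Metric.ball_subset_closedBall

theorem lintegral_discMeasure_norm {F : ℝ → ℝ} (hF : Continuous F) (h0 : ∀ r, 0 ≤ F r) :
    ∫⁻ x : Plane, ENNReal.ofReal (F ‖x‖) ∂discMeasure =
      ENNReal.ofReal (2 * Real.pi * ∫ r in (0 : ℝ)..1, r * F r) := by
  rw [← ofReal_integral_eq_lintegral_ofReal (integrable_discMeasure_of_continuous hF)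
    (Filter.Eventually.of_forall fun x => h0 _), integral_discMeasure_norm]

theorem inner_discL2_radial {e e' : DiscL2} {F G : ℝ → ℝ}
    (he : ∀ᵐ x ∂discMeasure, e x = (F ‖x‖ : ℂ)) (he' : ∀ᵐ x ∂discMeasure, e' x = (G ‖x‖ : ℂ)) :
    inner ℂ e e' = ((2 * Real.pi * ∫ r in (0 : ℝ)..1, r * (F r * G r) : ℝ) : ℂ) := by
  rw [L2.inner_def, ← integral_discMeasure_norm (fun r => F r * G r), ← integral_complex_ofReal]
  refine integral_congr_ae ?_
  filter_upwards [he, he'] with x hx hx'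
  rw [hx, hx']
  simp [mul_comm]

theorem hasDerivAt_besselJ_scaled (z r : ℝ) :
    HasDerivAt (fun r => besselJ (z * r)) (z * besselJ' (z * r)) r := by
  have : HasDerivAt (fun r : ℝ => z * r) z r := by simpa using (hasDerivAt_id r).const_mul z
  exact ((hasDerivAt_besselJ (z * r)).comp r this).congr_deriv (mul_comm _ _)

theorem hasDerivAt_mul_besselJ'_scaled (z r : ℝ) :
    HasDerivAt (fun r => r * (z * besselJ' (z * r))) (-(z ^ 2 * (r * besselJ (z * r)))) r := by
  have h : HasDerivAt (fun r : ℝ => z * r) z r := by simpa using (hasDerivAt_id r).const_mul z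
  have h2 : HasDerivAt (fun r => z * r * besselJ' (z * r)) (-(z * r * besselJ (z * r)) * z) r :=
    (hasDerivAt_mul_besselJ' (z * r)).comp r h
  refine (h2.congr_deriv (by ring)).congr_of_eventuallyEq (Filter.Eventually.of_forall fun s => ?_)
  simp only; ring

theorem continuous_besselJ_scaled (z : ℝ) : Continuous fun r => besselJ (z * r) :=
  continuous_besselJ.comp (by fun_prop)

theorem continuous_besselJ'_scaled (z : ℝ) : Continuous fun r => besselJ' (z * r) :=
  continuous_besselJ'.comp (by fun_prop)

/-- Integration by parts: the boundary term vanishes at 0 through the factor `r` and at 1 through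
`J₀(w) = 0`. Only `w` has to be a zero; exchanging the roles of `z` and `w` then gives
orthogonality. -/
theorem integral_besselJ'_mul (z : ℝ) {w : ℝ} (hw : besselJ w = 0) :
    ∫ r in (0 : ℝ)..1, r * ((z * besselJ' (z * r)) * (w * besselJ' (w * r))) =
      z ^ 2 * ∫ r in (0 : ℝ)..1, r * (besselJ (z * r) * besselJ (w * r)) := by
  have c1 := continuous_besselJ_scaled z
  have c2 := continuous_besselJ_scaled w
  have c3 := continuous_besselJ'_scaled z
  have c4 := continuous_besselJ'_scaled w
  have h := intervalIntegral.integral_eq_sub_of_hasDerivAt (a := 0) (b := 1)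
    (f := fun r => r * (z * besselJ' (z * r)) * besselJ (w * r))
    (f' := fun r => r * ((z * besselJ' (z * r)) * (w * besselJ' (w * r))) -
      z ^ 2 * (r * (besselJ (z * r) * besselJ (w * r))))
    (fun r _ => ((hasDerivAt_mul_besselJ'_scaled z r).mul
      (hasDerivAt_besselJ_scaled w r)).congr_deriv (by ring))
    (Continuous.intervalIntegrable (by fun_prop) _ _)
  rw [intervalIntegral.integral_sub (Continuous.intervalIntegrable (by fun_prop) _ _)
    (Continuous.intervalIntegrable (by fun_prop) _ _), intervalIntegral.integral_const_mul] at h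
  simp only [mul_one, hw, mul_zero, zero_mul, sub_zero] at h
  linarith

theorem integral_besselJ_mul_eq_zero {z w : ℝ} (hz0 : 0 < z) (hw0 : 0 < w) (hz : besselJ z = 0)
    (hw : besselJ w = 0) (hne : z ≠ w) :
    ∫ r in (0 : ℝ)..1, r * (besselJ (z * r) * besselJ (w * r)) = 0 := by
  have h1 := integral_besselJ'_mul z hw
  have h2 := integral_besselJ'_mul w hz
  have e1 : ∀ r : ℝ, r * ((w * besselJ' (w * r)) * (z * besselJ' (z * r))) =
    r * ((z * besselJ' (z * r)) * (w * besselJ' (w * r))) := fun r => by ring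
  have e2 : ∀ r : ℝ, r * (besselJ (w * r) * besselJ (z * r)) =
    r * (besselJ (z * r) * besselJ (w * r)) := fun r => by ring
  simp_rw [e1, e2] at h2
  rw [h1] at h2
  have h3 : (z ^ 2 - w ^ 2) * ∫ r in (0 : ℝ)..1, r * (besselJ (z * r) * besselJ (w * r)) = 0 := by
    linarith
  refine (mul_eq_zero.1 h3).resolve_left fun hc => hne ?_
  exact (sq_eq_sq₀ hz0.le hw0.le).1 (by linarith)

/-- A Pohozaev-type identity: with `f(r) = J₀(z r)`, the function `(r f') ^ 2 + z ^ 2 r ^ 2 f ^ 2`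
is a primitive of `2 z ^ 2 r f ^ 2`. -/
theorem integral_besselJ_sq {z : ℝ} (hz0 : 0 < z) (hz : besselJ z = 0) :
    ∫ r in (0 : ℝ)..1, r * (besselJ (z * r) * besselJ (z * r)) = besselJ' z ^ 2 / 2 := by
  have c1 := continuous_besselJ_scaled z
  have h := intervalIntegral.integral_eq_sub_of_hasDerivAt (a := 0) (b := 1)
    (f := fun r => (r * (z * besselJ' (z * r))) ^ 2 + z ^ 2 * (r ^ 2 * besselJ (z * r) ^ 2))
    (f' := fun r => 2 * z ^ 2 * (r * (besselJ (z * r) * besselJ (z * r))))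
    (fun r _ => (((hasDerivAt_mul_besselJ'_scaled z r).pow 2).add (((hasDerivAt_pow 2 r).mul
      ((hasDerivAt_besselJ_scaled z r).pow 2)).const_mul (z ^ 2))).congr_deriv
        (by simp; ring))
    (Continuous.intervalIntegrable (by fun_prop) _ _)
  rw [intervalIntegral.integral_const_mul] at h
  simp only [mul_one, hz, one_mul, zero_mul] at h
  have h2 : 2 * z ^ 2 * ((∫ r in (0 : ℝ)..1, r * (besselJ (z * r) * besselJ (z * r))) -
      besselJ' z ^ 2 / 2) = 0 := by
    rw [mul_sub, h]; ring
  have h3 := (mul_eq_zero.1 h2).resolve_left (by positivity)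
  linarith

theorem norm_sq_discL2_radial {e : DiscL2} {F : ℝ → ℝ}
    (he : ∀ᵐ x ∂discMeasure, e x = (F ‖x‖ : ℂ)) :
    ‖e‖ ^ 2 = 2 * Real.pi * ∫ r in (0 : ℝ)..1, r * (F r * F r) := by
  have h := inner_discL2_radial he he
  rw [inner_self_eq_norm_sq_to_K] at h
  have h2 : ((‖e‖ ^ 2 : ℝ) : ℂ) = ((2 * Real.pi * ∫ r in (0 : ℝ)..1, r * (F r * F r) : ℝ) : ℂ) := by
    rw [← h]; push_cast; rfl
  exact Complex.ofReal_injective h2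

theorem integral_scaled_besselJ_sq {z : ℝ} (hz0 : 0 < z) (hz : besselJ z = 0) (c : ℝ) :
    2 * Real.pi * ∫ r in (0 : ℝ)..1, r * ((c * besselJ (z * r)) * (c * besselJ (z * r))) =
      c ^ 2 * (Real.pi * besselJ' z ^ 2) := by
  have : ∀ r : ℝ, r * ((c * besselJ (z * r)) * (c * besselJ (z * r))) =
    c ^ 2 * (r * (besselJ (z * r) * besselJ (z * r))) := fun r => by ring
  simp_rw [this]
  rw [intervalIntegral.integral_const_mul, integral_besselJ_sq hz0 hz]
  ring

/-- Ensures that the choice defining `radialEigenfunction` has a witness. -/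
theorem exists_isNormalizedEigenvector {z : ℝ} (hz0 : 0 < z) (hz : besselJ z = 0) :
    ∃ e, IsNormalizedEigenvector z e := by
  have hD := one_fourth_le_of_besselJ_eq_zero hz0.le hz
  have hD0 : 0 < besselJ' z ^ 2 := by
    by_contra! hc
    nlinarith
  set c : ℝ := 1 / √(Real.pi * besselJ' z ^ 2) with hc
  have hpos : 0 < Real.pi * besselJ' z ^ 2 := mul_pos Real.pi_pos hD0
  have hc0 : c ≠ 0 := by positivity
  have hcont : Continuous fun x : Plane => ((c * radialBessel z x : ℝ) : ℂ) :=
    Complex.continuous_ofReal.comp ((contDiff_radialBessel z).continuous.const_mul c)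
  have hmem : MemLp (fun x : Plane => ((c * radialBessel z x : ℝ) : ℂ)) 2 discMeasure := by
    refine MemLp.of_bound hcont.aestronglyMeasurable |c| (Filter.Eventually.of_forall fun x => ?_)
    rw [Complex.norm_real, norm_mul, Real.norm_eq_abs, Real.norm_eq_abs]
    exact mul_le_of_le_one_right (abs_nonneg _) (abs_besselJ_le_one (by positivity))
  refine ⟨hmem.toLp _, ?_, _, isRadialDirichletEigenfunction_const_mul_radialBessel hz hc0,
    hmem.coeFn_toLp⟩
  have := norm_sq_discL2_radial (F := fun r => c * besselJ (z * r)) hmem.coeFn_toLp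
  have hc2 : c ^ 2 * (Real.pi * besselJ' z ^ 2) = 1 := by
    rw [hc, div_pow, Real.sq_sqrt hpos.le, one_pow, one_div_mul_cancel hpos.ne']
  rw [integral_scaled_besselJ_sq hz0 hz, hc2] at this
  exact (pow_eq_one_iff_of_nonneg (norm_nonneg _) two_ne_zero).1 this

theorem exists_radialEigenfunction_eq (n : ℕ) :
    ∃ c : ℝ, c ^ 2 * (Real.pi * besselJ' (radialFreq n) ^ 2) = 1 ∧ ∀ᵐ x ∂discMeasure,
      radialEigenfunction n x = ((c * besselJ (radialFreq n * ‖x‖) : ℝ) : ℂ) := by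
  have hz0 := radialFreq_pos n
  have hz := besselJ_radialFreq n
  obtain ⟨hnorm, f, hf, hae⟩ : IsNormalizedEigenvector (radialFreq n) (radialEigenfunction n) :=
    Classical.epsilon_spec (exists_isNormalizedEigenvector hz0 hz)
  have hae' : ∀ᵐ x ∂discMeasure,
      radialEigenfunction n x = ((f 0 * besselJ (radialFreq n * ‖x‖) : ℝ) : ℂ) := by
    have hmem : ∀ᵐ x ∂discMeasure, x ∈ disc := ae_restrict_mem measurableSet_ball
    filter_upwards [hae, hmem] with x hx hxd
    rw [hx, hf.eq_mul_radialBessel hz0 hxd, radialBessel]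
  refine ⟨f 0, ?_, hae'⟩
  have := norm_sq_discL2_radial (F := fun r => f 0 * besselJ (radialFreq n * r)) hae'
  rw [integral_scaled_besselJ_sq hz0 hz, hnorm] at this
  linarith

/-- The amplitude of the `n`-th normalized radial eigenfunction. -/
noncomputable def radialAmplitude (n : ℕ) : ℝ := (exists_radialEigenfunction_eq n).choose

theorem radialAmplitude_sq_mul (n : ℕ) :
    radialAmplitude n ^ 2 * (Real.pi * besselJ' (radialFreq n) ^ 2) = 1 :=
  (exists_radialEigenfunction_eq n).choose_spec.1

/-- The profile of the `n`-th normalized radial eigenfunction. -/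
noncomputable def radialMode (n : ℕ) (r : ℝ) : ℝ := radialAmplitude n * besselJ (radialFreq n * r)

/-- The derivative of `radialMode n`. -/
noncomputable def radialMode' (n : ℕ) (r : ℝ) : ℝ :=
  radialAmplitude n * (radialFreq n * besselJ' (radialFreq n * r))

theorem radialEigenfunction_ae_eq (n : ℕ) :
    ∀ᵐ x ∂discMeasure, radialEigenfunction n x = (radialMode n ‖x‖ : ℂ) :=
  (exists_radialEigenfunction_eq n).choose_spec.2

theorem hasDerivAt_radialMode (n : ℕ) (r : ℝ) :
    HasDerivAt (radialMode n) (radialMode' n r) r :=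
  (hasDerivAt_besselJ_scaled (radialFreq n) r).const_mul _

theorem continuous_radialMode (n : ℕ) : Continuous (radialMode n) :=
  (continuous_besselJ_scaled _).const_mul _

theorem continuous_radialMode' (n : ℕ) : Continuous (radialMode' n) :=
  ((continuous_besselJ'_scaled _).const_mul _).const_mul _

theorem radialMode_one (n : ℕ) : radialMode n 1 = 0 := by
  simp [radialMode, besselJ_radialFreq]

theorem integral_radialMode_mul (n m : ℕ) :
    2 * Real.pi * ∫ r in (0 : ℝ)..1, r * (radialMode n r * radialMode m r) =
      if n = m then 1 else 0 := by
  split_ifs with h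
  · subst h
    exact (integral_scaled_besselJ_sq (radialFreq_pos n) (besselJ_radialFreq n) _).trans
      (radialAmplitude_sq_mul n)
  · have hne : radialFreq n ≠ radialFreq m := fun hc => h (strictMono_radialFreq.injective hc)
    have e : ∀ r : ℝ, r * (radialMode n r * radialMode m r) = (radialAmplitude n *
        radialAmplitude m) * (r * (besselJ (radialFreq n * r) * besselJ (radialFreq m * r))) :=
      fun r => by unfold radialMode; ring
    simp_rw [e]
    rw [intervalIntegral.integral_const_mul, integral_besselJ_mul_eq_zero (radialFreq_pos n)
      (radialFreq_pos m) (besselJ_radialFreq n) (besselJ_radialFreq m) hne]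
    simp

theorem integral_radialMode'_mul (n m : ℕ) :
    2 * Real.pi * ∫ r in (0 : ℝ)..1, r * (radialMode' n r * radialMode' m r) =
      if n = m then radialFreq n ^ 2 else 0 := by
  have e : ∀ r : ℝ, r * (radialMode' n r * radialMode' m r) =
      (radialAmplitude n * radialAmplitude m) * (r * ((radialFreq n * besselJ' (radialFreq n * r)) *
        (radialFreq m * besselJ' (radialFreq m * r)))) := fun r => by unfold radialMode'; ring
  have e' : ∀ r : ℝ, r * (radialMode n r * radialMode m r) = (radialAmplitude n *
      radialAmplitude m) * (r * (besselJ (radialFreq n * r) * besselJ (radialFreq m * r))) :=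
    fun r => by unfold radialMode; ring
  have h := integral_radialMode_mul n m
  simp_rw [e'] at h
  simp_rw [e]
  rw [intervalIntegral.integral_const_mul] at h ⊢
  rw [integral_besselJ'_mul _ (besselJ_radialFreq m)]
  have h2 := congrArg (fun t => radialFreq n ^ 2 * t) h
  simp only [mul_ite, mul_one, mul_zero] at h2
  rw [← h2]
  ring

theorem orthonormal_radialEigenfunction : Orthonormal ℂ radialEigenfunction := by
  rw [orthonormal_iff_ite]
  intro n m
  rw [inner_discL2_radial (radialEigenfunction_ae_eq n) (radialEigenfunction_ae_eq m),
    integral_radialMode_mul]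
  split_ifs <;> simp

/-- Normalization and the slope bound at the zero give amplitude squared at most `4 z / 3`; combine
with `t J₀ ^ 4 ≤ 4`. The sharper decay `t J₀ ^ 2 ≤ 4` alone would give a fourth power of size `r ^
(-2)`, which is not integrable on the disc. -/
theorem mul_radialMode_pow_four_le (n : ℕ) {r : ℝ} (hr : 0 ≤ r) :
    r * radialMode n r ^ 4 ≤ 9 * radialFreq n := by
  have hz := radialFreq_pos n
  have h1 := mul_besselJ_pow_four_le (mul_nonneg hz.le hr)
  have h2 := radialAmplitude_sq_mul n
  have h3 := one_fourth_le_of_besselJ_eq_zero hz.le (besselJ_radialFreq n)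
  set a := radialAmplitude n
  set z := radialFreq n
  set J := besselJ (z * r) with hJ
  have ha : a ^ 2 ≤ 4 / 3 * z := by
    have h4 : a ^ 2 * Real.pi * (z * besselJ' z ^ 2) = z := by
      calc _ = z * (a ^ 2 * (Real.pi * besselJ' z ^ 2)) := by ring
        _ = z := by rw [h2, mul_one]
    have h5 : a ^ 2 * 3 * (1 / 4) ≤ a ^ 2 * Real.pi * (z * besselJ' z ^ 2) := by
      gcongr
      exact Real.pi_gt_three.le
    linarith
  have ha4 : a ^ 4 ≤ (4 / 3 * z) ^ 2 := by
    have : a ^ 4 = (a ^ 2) ^ 2 := by ring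
    rw [this]; gcongr
  have h6 : z * (r * radialMode n r ^ 4) ≤ z * (9 * z) := by
    calc z * (r * radialMode n r ^ 4) = a ^ 4 * (z * r * J ^ 4) := by
          simp only [radialMode]; ring
      _ ≤ (4 / 3 * z) ^ 2 * 4 := by gcongr
      _ ≤ z * (9 * z) := by nlinarith [sq_nonneg z]
  exact le_of_mul_le_mul_left h6 hz

/-! ### Radial Gagliardo–Nirenberg inequality -/

/-- A radial Gagliardo–Nirenberg inequality on the unit disc. -/
theorem radial_gagliardo_nirenberg {u u' : ℝ → ℝ} (hu : ∀ r, HasDerivAt u (u' r) r)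
    (hu' : Continuous u') (h1 : u 1 = 0) :
    ∫ r in (0 : ℝ)..1, r * u r ^ 4 ≤
      4 * (∫ r in (0 : ℝ)..1, r * u r ^ 2) * ∫ r in (0 : ℝ)..1, r * u' r ^ 2 := by
  have hc : Continuous u := continuous_iff_continuousAt.2 fun r => (hu r).continuousAt
  have hint : ∀ {g : ℝ → ℝ} (a b : ℝ), Continuous g → IntervalIntegrable g volume a b :=
    fun a b hg => hg.intervalIntegrable a b
  have hsq : ∀ r, HasDerivAt (fun r => u r ^ 2) (2 * (u r * u' r)) r := fun r =>
    ((hu r).pow 2).congr_deriv (by simp; ring)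
  set I := ∫ s in (0 : ℝ)..1, s * (2 * |u s * u' s|) with hI
  -- Write `u(r) ^ 2` as the integral of `-(u ^ 2)'` over `[r, 1]` and replace the factor `r` by the
  -- larger `s`.
  have hpt : ∀ r ∈ Set.Icc (0 : ℝ) 1, r * u r ^ 2 ≤ I := by
    intro r hr
    have e1 := intervalIntegral.integral_eq_sub_of_hasDerivAt (a := r) (b := 1)
      (fun x _ => hsq x) (hint _ _ (by fun_prop))
    rw [h1] at e1
    have e2 : u r ^ 2 = ∫ s in r..1, -(2 * (u s * u' s)) := by
      rw [intervalIntegral.integral_neg, e1]; ring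
    have e3 : r * u r ^ 2 ≤ ∫ s in r..1, s * (2 * |u s * u' s|) := by
      rw [e2, ← intervalIntegral.integral_const_mul]
      refine intervalIntegral.integral_mono_on hr.2 (hint _ _ (by fun_prop))
        (hint _ _ (by fun_prop)) fun s hs => ?_
      have h3 : -(2 * (u s * u' s)) ≤ 2 * |u s * u' s| := by
        linarith [neg_abs_le (u s * u' s)]
      calc r * -(2 * (u s * u' s)) ≤ r * (2 * |u s * u' s|) :=
            mul_le_mul_of_nonneg_left h3 hr.1
        _ ≤ _ := mul_le_mul_of_nonneg_right hs.1 (by positivity)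
    have e4 : 0 ≤ ∫ s in (0 : ℝ)..r, s * (2 * |u s * u' s|) :=
      intervalIntegral.integral_nonneg hr.1 fun s hs => mul_nonneg hs.1 (by positivity)
    have e5 := intervalIntegral.integral_add_adjacent_intervals (a := 0) (b := r) (c := 1)
      (f := fun s => s * (2 * |u s * u' s|)) (μ := volume)
      (hint _ _ (by fun_prop)) (hint _ _ (by fun_prop))
    linarith
  -- Integrate the derivative of `r u ^ 2`, which vanishes at both ends.
  have hL1 : ∫ r in (0 : ℝ)..1, u r ^ 2 ≤ I := by
    have e1 := intervalIntegral.integral_eq_sub_of_hasDerivAt (a := 0) (b := 1)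
      (f := fun r => r * u r ^ 2) (f' := fun r => u r ^ 2 + r * (2 * (u r * u' r)))
      (fun x _ => ((hasDerivAt_id x).mul (hsq x)).congr_deriv (by simp))
      (hint _ _ (by fun_prop))
    rw [h1, intervalIntegral.integral_add (hint _ _ (by fun_prop)) (hint _ _ (by fun_prop))] at e1
    have e2 : ∫ r in (0 : ℝ)..1, -(r * (2 * (u r * u' r))) ≤ I := by
      refine intervalIntegral.integral_mono_on zero_le_one (hint _ _ (by fun_prop))
        (hint _ _ (by fun_prop)) fun s hs => ?_
      have h3 : -(2 * (u s * u' s)) ≤ 2 * |u s * u' s| := by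
        linarith [neg_abs_le (u s * u' s)]
      calc -(s * (2 * (u s * u' s))) = s * -(2 * (u s * u' s)) := by ring
        _ ≤ _ := mul_le_mul_of_nonneg_left h3 hs.1
    rw [intervalIntegral.integral_neg] at e2
    have e3 : (1 : ℝ) * 0 ^ 2 - 0 * u 0 ^ 2 = 0 := by ring
    rw [e3] at e1
    linarith
  have hI0 : 0 ≤ I :=
    intervalIntegral.integral_nonneg zero_le_one fun s hs => mul_nonneg hs.1 (by positivity)
  have h4 : ∫ r in (0 : ℝ)..1, r * u r ^ 4 ≤ I ^ 2 := by
    calc ∫ r in (0 : ℝ)..1, r * u r ^ 4 ≤ ∫ r in (0 : ℝ)..1, I * u r ^ 2 := by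
          refine intervalIntegral.integral_mono_on zero_le_one (hint _ _ (by fun_prop))
            (hint _ _ (by fun_prop)) fun s hs => ?_
          calc s * u s ^ 4 = (s * u s ^ 2) * u s ^ 2 := by ring
            _ ≤ I * u s ^ 2 := mul_le_mul_of_nonneg_right (hpt s hs) (sq_nonneg _)
      _ = I * ∫ r in (0 : ℝ)..1, u r ^ 2 := intervalIntegral.integral_const_mul _ _
      _ ≤ I * I := mul_le_mul_of_nonneg_left hL1 hI0
      _ = I ^ 2 := by ring
  -- Cauchy–Schwarz for the weight `r`, as nonpositivity of the discriminant of the integral of `r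
  -- (|u| t - |u'|) ^ 2`.
  have hdisc : discrim (∫ r in (0 : ℝ)..1, r * u r ^ 2) (-I)
      (∫ r in (0 : ℝ)..1, r * u' r ^ 2) ≤ 0 := by
    refine discrim_le_zero fun t => ?_
    have : (∫ r in (0 : ℝ)..1, r * u r ^ 2) * (t * t) + -I * t +
        (∫ r in (0 : ℝ)..1, r * u' r ^ 2) =
        ∫ r in (0 : ℝ)..1, (r * u r ^ 2 * (t * t) + -(r * (2 * |u r * u' r|)) * t +
          r * u' r ^ 2) := by
      rw [intervalIntegral.integral_add (hint _ _ (by fun_prop)) (hint _ _ (by fun_prop)),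
        intervalIntegral.integral_add (hint _ _ (by fun_prop)) (hint _ _ (by fun_prop)),
        intervalIntegral.integral_mul_const, intervalIntegral.integral_mul_const,
        intervalIntegral.integral_neg]
    rw [this]
    refine intervalIntegral.integral_nonneg zero_le_one fun s hs => ?_
    have e : s * u s ^ 2 * (t * t) + -(s * (2 * |u s * u' s|)) * t + s * u' s ^ 2 =
        s * (|u s| * t - |u' s|) ^ 2 := by
      rw [abs_mul, ← sq_abs (u s), ← sq_abs (u' s)]; ring
    rw [e]
    exact mul_nonneg hs.1 (sq_nonneg _)
  rw [discrim] at hdisc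
  nlinarith

theorem hasDerivAt_sum_radialMode (s : Finset ℕ) (a : ℕ → ℝ) (r : ℝ) :
    HasDerivAt (fun r => ∑ n ∈ s, a n * radialMode n r) (∑ n ∈ s, a n * radialMode' n r) r :=
  HasDerivAt.fun_sum fun n _ => (hasDerivAt_radialMode n r).const_mul (a n)

theorem integral_sum_sq {e : ℕ → ℝ → ℝ} (he : ∀ n, Continuous (e n)) {w : ℕ → ℝ}
    (h : ∀ n m, 2 * Real.pi * ∫ r in (0 : ℝ)..1, r * (e n r * e m r) = if n = m then w n else 0)
    (s : Finset ℕ) (a : ℕ → ℝ) :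
    2 * Real.pi * ∫ r in (0 : ℝ)..1, r * (∑ n ∈ s, a n * e n r) ^ 2 =
      ∑ n ∈ s, a n ^ 2 * w n := by
  have e1 : ∀ r : ℝ, r * (∑ n ∈ s, a n * e n r) ^ 2 =
      ∑ n ∈ s, ∑ m ∈ s, a n * a m * (r * (e n r * e m r)) := by
    intro r
    rw [sq, Finset.sum_mul_sum, Finset.mul_sum]
    refine Finset.sum_congr rfl fun n _ => ?_
    rw [Finset.mul_sum]
    exact Finset.sum_congr rfl fun m _ => by ring
  simp_rw [e1]
  rw [intervalIntegral.integral_finsetSum fun n _ =>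
    (continuous_finsetSum _ fun m _ => by
      have := he n; have := he m; fun_prop : Continuous _).intervalIntegrable _ _]
  rw [Finset.mul_sum]
  refine Finset.sum_congr rfl fun n hn => ?_
  rw [intervalIntegral.integral_finsetSum fun m _ =>
    (by have := he n; have := he m; fun_prop : Continuous _).intervalIntegrable _ _, Finset.mul_sum]
  rw [Finset.sum_eq_single n]
  · rw [intervalIntegral.integral_const_mul]
    have := h n n
    rw [if_pos rfl] at this
    rw [← this]; ring
  · intro m _ hm
    rw [intervalIntegral.integral_const_mul]
    have := h n m
    rw [if_neg hm.symm] at this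
    linear_combination (a n * a m) * this
  · intro hc; exact absurd hn hc

theorem integral_sum_radialMode_pow_four_le (s : Finset ℕ) (a : ℕ → ℝ) :
    2 * Real.pi * ∫ r in (0 : ℝ)..1, r * (∑ n ∈ s, a n * radialMode n r) ^ 4 ≤
      (∑ n ∈ s, a n ^ 2) * ∑ n ∈ s, a n ^ 2 * radialFreq n ^ 2 := by
  have h := radial_gagliardo_nirenberg (hasDerivAt_sum_radialMode s a)
    (continuous_finsetSum _ fun n _ => (continuous_radialMode' n).const_mul (a n))
    (by simp [radialMode_one])
  have h1 := integral_sum_sq continuous_radialMode integral_radialMode_mul s a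
  have h2 := integral_sum_sq continuous_radialMode' integral_radialMode'_mul s a
  simp only [mul_one] at h1
  rw [← h1, ← h2]
  set A := ∫ r in (0 : ℝ)..1, r * (∑ n ∈ s, a n * radialMode n r) ^ 2
  set B := ∫ r in (0 : ℝ)..1, r * (∑ n ∈ s, a n * radialMode' n r) ^ 2
  have hA : 0 ≤ A := intervalIntegral.integral_nonneg zero_le_one fun r hr =>
    mul_nonneg hr.1 (sq_nonneg _)
  have hB : 0 ≤ B := intervalIntegral.integral_nonneg zero_le_one fun r hr =>
    mul_nonneg hr.1 (sq_nonneg _)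
  have hpi := Real.pi_gt_three
  -- Since `4 ≤ 2 π`, the constant 4 is absorbed by the second polar factor.
  calc _ ≤ 2 * Real.pi * (4 * A * B) := by gcongr
    _ = (2 * Real.pi) * 4 * (A * B) := by ring
    _ ≤ (2 * Real.pi) * (2 * Real.pi) * (A * B) := by
        have := mul_nonneg hA hB
        gcongr; linarith
    _ = _ := by ring

theorem norm_pow_four_le (w : ℂ) : ‖w‖ ^ 4 ≤ 2 * (w.re ^ 4 + w.im ^ 4) := by
  have h : ‖w‖ ^ 2 = w.re ^ 2 + w.im ^ 2 := by
    rw [Complex.sq_norm, Complex.normSq_apply]; ring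
  have : ‖w‖ ^ 4 = (‖w‖ ^ 2) ^ 2 := by ring
  rw [this, h]
  nlinarith [sq_nonneg (w.re ^ 2 - w.im ^ 2)]

/-- The Gagliardo–Nirenberg inequality for finite combinations of the radial eigenfunctions. -/
theorem lintegral_sum_radialMode_pow_four_le (s : Finset ℕ) (c : ℕ → ℂ) :
    ∫⁻ x, ‖∑ n ∈ s, c n * (radialMode n ‖x‖ : ℂ)‖ₑ ^ 4 ∂discMeasure ≤
      ENNReal.ofReal (2 * ((∑ n ∈ s, ‖c n‖ ^ 2) * ∑ n ∈ s, ‖c n‖ ^ 2 * radialFreq n ^ 2)) := by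
  set u : ℝ → ℝ := fun r => ∑ n ∈ s, (c n).re * radialMode n r with hu
  set v : ℝ → ℝ := fun r => ∑ n ∈ s, (c n).im * radialMode n r with hv
  have hcu : Continuous u := continuous_finsetSum _ fun n _ => (continuous_radialMode n).const_mul _
  have hcv : Continuous v := continuous_finsetSum _ fun n _ => (continuous_radialMode n).const_mul _
  have hpt : ∀ x : Plane, ‖∑ n ∈ s, c n * (radialMode n ‖x‖ : ℂ)‖ₑ ^ 4 ≤
      ENNReal.ofReal (2 * (u ‖x‖ ^ 4 + v ‖x‖ ^ 4)) := by
    intro x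
    rw [← ofReal_norm, ← ENNReal.ofReal_pow (norm_nonneg _)]
    refine ENNReal.ofReal_le_ofReal ((norm_pow_four_le _).trans (le_of_eq ?_))
    simp [hu, hv]
  refine (lintegral_mono hpt).trans ?_
  rw [lintegral_discMeasure_norm (F := fun r => 2 * (u r ^ 4 + v r ^ 4)) (by fun_prop)
    (fun r => by positivity)]
  refine ENNReal.ofReal_le_ofReal ?_
  have e : ∀ r : ℝ, r * (2 * (u r ^ 4 + v r ^ 4)) = 2 * (r * u r ^ 4) + 2 * (r * v r ^ 4) :=
    fun r => by ring
  simp_rw [e]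
  rw [intervalIntegral.integral_add (Continuous.intervalIntegrable (by fun_prop) _ _)
    (Continuous.intervalIntegrable (by fun_prop) _ _), intervalIntegral.integral_const_mul,
    intervalIntegral.integral_const_mul]
  have h1 := integral_sum_radialMode_pow_four_le s fun n => (c n).re
  have h2 := integral_sum_radialMode_pow_four_le s fun n => (c n).im
  have hn : ∀ n, ‖c n‖ ^ 2 = (c n).re ^ 2 + (c n).im ^ 2 := fun n => by
    rw [Complex.sq_norm, Complex.normSq_apply]; ring
  simp_rw [hn, add_mul, Finset.sum_add_distrib]
  have p1 : 0 ≤ ∑ n ∈ s, (c n).re ^ 2 := Finset.sum_nonneg fun n _ => by positivity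
  have p2 : 0 ≤ ∑ n ∈ s, (c n).im ^ 2 := Finset.sum_nonneg fun n _ => by positivity
  have p3 : 0 ≤ ∑ n ∈ s, (c n).re ^ 2 * radialFreq n ^ 2 :=
    Finset.sum_nonneg fun n _ => by positivity
  have p4 : 0 ≤ ∑ n ∈ s, (c n).im ^ 2 * radialFreq n ^ 2 :=
    Finset.sum_nonneg fun n _ => by positivity
  nlinarith [mul_nonneg p1 p4, mul_nonneg p2 p3]

/-! ### Gaussian exponential and moment bounds -/

theorem map_re_complexGaussian : complexGaussian.map Complex.re = gaussianReal 0 (1 / 2) := by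
  rw [complexGaussian, Measure.map_map Complex.measurable_re (MeasurableEquiv.measurable _)]
  have : Complex.re ∘ Complex.measurableEquivRealProd.symm = Prod.fst := by
    ext p; simp [Complex.measurableEquivRealProd]
  rw [this, Measure.map_fst_prod]; simp

theorem map_im_complexGaussian : complexGaussian.map Complex.im = gaussianReal 0 (1 / 2) := by
  rw [complexGaussian, Measure.map_map Complex.measurable_im (MeasurableEquiv.measurable _)]
  have : Complex.im ∘ Complex.measurableEquivRealProd.symm = Prod.snd := by
    ext p; simp [Complex.measurableEquivRealProd]
  rw [this, Measure.map_snd_prod]; simp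

theorem map_eval_gaussianSequence (n : ℕ) :
    gaussianSequence.map (fun g => g n) = complexGaussian :=
  Measure.infinitePi_map_eval _ n

theorem iIndepFun_gaussianSequence {X : ℕ → ℂ → ℝ} (hX : ∀ n, Measurable (X n)) :
    iIndepFun (fun n (g : ℕ → ℂ) => X n (g n)) gaussianSequence :=
  iIndepFun_infinitePi hX

theorem integrable_comp_eval_gaussianSequence {F : ℂ → ℝ} (hF : Integrable F complexGaussian)
    (n : ℕ) : Integrable (fun g : ℕ → ℂ => F (g n)) gaussianSequence := by
  rw [← map_eval_gaussianSequence n] at hF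
  exact hF.comp_measurable (measurable_pi_apply n)

theorem mgf_eval_gaussianSequence {X : ℂ → ℝ} (hX : Measurable X) (n : ℕ) (t : ℝ) :
    mgf (fun g : ℕ → ℂ => X (g n)) gaussianSequence t = mgf X complexGaussian t := by
  have h := mgf_map (μ := gaussianSequence) (Y := fun g : ℕ → ℂ => g n) (X := X) (t := t)
    (measurable_pi_apply n).aemeasurable (by fun_prop)
  rw [map_eval_gaussianSequence n] at h
  exact h.symm

/-- Fernique's theorem for each real coordinate; the exponential of `‖w‖ ^ 2` factors over the
product law. -/
theorem exists_integrable_exp_norm_sq_complexGaussian :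
    ∃ κ : ℝ, 0 < κ ∧ Integrable (fun w : ℂ => Real.exp (κ * ‖w‖ ^ 2)) complexGaussian := by
  obtain ⟨κ, hκ, hint⟩ := IsGaussian.exists_integrable_exp_sq (gaussianReal 0 (1 / 2))
  refine ⟨κ, hκ, ?_⟩
  rw [complexGaussian, integrable_map_equiv]
  refine (hint.mul_prod hint).congr (Filter.Eventually.of_forall fun p => ?_)
  have h : ‖Complex.measurableEquivRealProd.symm p‖ ^ 2 = p.1 ^ 2 + p.2 ^ 2 := by
    rw [Complex.sq_norm, Complex.normSq_apply]
    simp [Complex.measurableEquivRealProd]; ring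
  simp only [Function.comp, h, Real.norm_eq_abs, sq_abs, ← Real.exp_add]
  ring_nf

/-- A large deviation bound for the sum of the squares of the first Gaussian variables. -/
theorem exists_measure_sum_norm_sq_le :
    ∃ κ K : ℝ, 0 < κ ∧ 1 ≤ K ∧ ∀ (N : ℕ) (T : ℝ),
      gaussianSequence {g | T ≤ ∑ n ∈ Finset.range N, ‖g n‖ ^ 2} ≤
        ENNReal.ofReal (K ^ N * Real.exp (-κ * T)) := by
  obtain ⟨κ, hκ, hint⟩ := exists_integrable_exp_norm_sq_complexGaussian
  have hm : Measurable fun w : ℂ => ‖w‖ ^ 2 := by fun_prop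
  -- Chernoff bound with independence. The maximum with 1 keeps `log K` nonnegative for later use.
  refine ⟨κ, mgf (fun w : ℂ => ‖w‖ ^ 2) complexGaussian κ ⊔ 1, hκ, le_max_right _ _, fun N T => ?_⟩
  have hind := iIndepFun_gaussianSequence (X := fun _ w => ‖w‖ ^ 2) fun _ => hm
  have hmeas : ∀ n : ℕ, Measurable fun g : ℕ → ℂ => ‖g n‖ ^ 2 := fun n => by fun_prop
  have h1 := measure_ge_le_exp_mul_mgf T hκ.le (hind.integrable_exp_mul_sum hmeas
    (s := Finset.range N) (t := κ) fun n _ => integrable_comp_eval_gaussianSequence hint n)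
  rw [hind.mgf_sum hmeas] at h1
  simp_rw [mgf_eval_gaussianSequence hm] at h1
  rw [Finset.prod_const, Finset.card_range] at h1
  rw [← ofReal_measureReal]
  refine ENNReal.ofReal_le_ofReal ?_
  simp only [Finset.sum_apply] at h1
  refine h1.trans ?_
  rw [mul_comm]
  gcongr
  · exact mgf_nonneg
  · exact le_max_left _ _

theorem integrable_exp_sum_gaussianSequence {X : ℂ → ℝ} (hX : Measurable X)
    (hlaw : complexGaussian.map X = gaussianReal 0 (1 / 2)) (b : ℕ → ℝ) (s : Finset ℕ) (t : ℝ) :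
    Integrable (fun g : ℕ → ℂ => Real.exp (t * ∑ n ∈ s, b n * X (g n))) gaussianSequence := by
  have hind := iIndepFun_gaussianSequence (X := fun n w => b n * X w) fun _ => by fun_prop
  have hmeas : ∀ n : ℕ, Measurable fun g : ℕ → ℂ => b n * X (g n) := fun n => by fun_prop
  have := hind.integrable_exp_mul_sum hmeas (s := s) (t := t) fun n _ => by
    refine integrable_comp_eval_gaussianSequence (F := fun w => Real.exp (t * (b n * X w))) ?_ n
    have := integrable_exp_mul_gaussianReal (μ := 0) (v := 1 / 2) (t * b n)
    rw [← hlaw] at this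
    simpa [Function.comp_def, mul_assoc] using this.comp_measurable hX
  simpa [Finset.sum_apply] using this

theorem integral_exp_sum_gaussianSequence {X : ℂ → ℝ} (hX : Measurable X)
    (hlaw : complexGaussian.map X = gaussianReal 0 (1 / 2)) (b : ℕ → ℝ) (s : Finset ℕ) (t : ℝ) :
    ∫ g, Real.exp (t * ∑ n ∈ s, b n * X (g n)) ∂gaussianSequence =
      Real.exp (t ^ 2 / 4 * ∑ n ∈ s, b n ^ 2) := by
  have hind := iIndepFun_gaussianSequence (X := fun n w => b n * X w) fun _ => by fun_prop
  have hmeas : ∀ n : ℕ, Measurable fun g : ℕ → ℂ => b n * X (g n) := fun n => by fun_prop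
  have h := hind.mgf_sum hmeas (t := t) s
  have h2 : ∀ n, mgf (fun g : ℕ → ℂ => b n * X (g n)) gaussianSequence t =
      Real.exp (t ^ 2 / 4 * b n ^ 2) := fun n => by
    rw [mgf_const_mul, mgf_eval_gaussianSequence hX, mgf_gaussianReal hlaw]
    congr 1
    push_cast; ring
  simp_rw [h2] at h
  rw [← Real.exp_sum, ← Finset.mul_sum] at h
  rw [← h, mgf]
  simp [Finset.sum_apply]

/-- Bound `(t S) ^ (4k)` by `(4k)!` times `exp(t S) + exp(-t S)`, integrate the exponentials exactly
and optimize in `t`. -/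
theorem lintegral_sum_gaussianSequence_pow_le {X : ℂ → ℝ} (hX : Measurable X)
    (hlaw : complexGaussian.map X = gaussianReal 0 (1 / 2)) (b : ℕ → ℝ) (s : Finset ℕ) {W : ℝ}
    (hW : 0 < W) (hb : ∑ n ∈ s, b n ^ 2 ≤ W) {k : ℕ} (hk : 0 < k) :
    ∫⁻ g, ENNReal.ofReal ((∑ n ∈ s, b n * X (g n)) ^ (4 * k)) ∂gaussianSequence ≤
      ENNReal.ofReal (2 * (2 * k * Real.exp 1 * W) ^ (2 * k)) := by
  have hk0 : (0 : ℝ) < k := by exact_mod_cast hk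
  -- This `t` minimizes `t ^ (-4k) exp(t ^ 2 W / 4)`; the exponent becomes `2k`.
  set t := √(8 * k / W) with ht
  have ht2 : t ^ 2 = 8 * k / W := Real.sq_sqrt (by positivity)
  have ht0 : 0 < t := by positivity
  set D : ℝ := (W / (8 * k)) ^ (2 * k) * ((4 * k : ℕ) : ℝ) ^ (4 * k) with hD
  have hpt : ∀ S : ℝ, S ^ (4 * k) ≤ D * (Real.exp (t * S) + Real.exp (-t * S)) := by
    intro S
    have h1 := Real.pow_div_factorial_le_exp _ (abs_nonneg (t * S)) (4 * k)
    have h2 : Real.exp |t * S| ≤ Real.exp (t * S) + Real.exp (-t * S) := by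
      rw [neg_mul]; exact Real.exp_abs_le _
    have h3 : |t * S| ^ (4 * k) = (8 * k / W) ^ (2 * k) * S ^ (4 * k) := by
      have e : 4 * k = 2 * (2 * k) := by ring
      rw [e, pow_mul, sq_abs, mul_pow, ht2, mul_pow, ← pow_mul]
    rw [h3, div_le_iff₀ (by positivity)] at h1
    have h4 : (((4 * k).factorial : ℕ) : ℝ) ≤ ((4 * k : ℕ) : ℝ) ^ (4 * k) := by
      exact_mod_cast Nat.factorial_le_pow _
    have h5 : S ^ (4 * k) = (W / (8 * k)) ^ (2 * k) * ((8 * k / W) ^ (2 * k) * S ^ (4 * k)) := by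
      rw [← mul_assoc, ← mul_pow]
      have : W / (8 * k) * (8 * k / W) = 1 := by field_simp
      rw [this, one_pow, one_mul]
    rw [h5, hD, mul_assoc]
    refine mul_le_mul_of_nonneg_left (h1.trans ?_) (by positivity)
    rw [mul_comm]
    gcongr
  have hD0 : 0 ≤ D := by positivity
  have i1 := integrable_exp_sum_gaussianSequence hX hlaw b s t
  have i2 := integrable_exp_sum_gaussianSequence hX hlaw b s (-t)
  calc _ ≤ ∫⁻ g, ENNReal.ofReal (D * (Real.exp (t * ∑ n ∈ s, b n * X (g n)) +
          Real.exp (-t * ∑ n ∈ s, b n * X (g n)))) ∂gaussianSequence :=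
        lintegral_mono fun g => ENNReal.ofReal_le_ofReal (hpt _)
    _ = ENNReal.ofReal (D * (2 * Real.exp (t ^ 2 / 4 * ∑ n ∈ s, b n ^ 2))) := by
        have i3 : Integrable (fun g : ℕ → ℂ => D * (Real.exp (t * ∑ n ∈ s, b n * X (g n)) +
          Real.exp (-t * ∑ n ∈ s, b n * X (g n)))) gaussianSequence := (i1.add i2).const_mul D
        rw [← ofReal_integral_eq_lintegral_ofReal i3
          (Filter.Eventually.of_forall fun g => by positivity), integral_const_mul,
          integral_add i1 i2, integral_exp_sum_gaussianSequence hX hlaw,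
          integral_exp_sum_gaussianSequence hX hlaw, neg_sq, two_mul]
    _ ≤ _ := by
        refine ENNReal.ofReal_le_ofReal ?_
        have h1 : t ^ 2 / 4 * ∑ n ∈ s, b n ^ 2 ≤ ((2 * k : ℕ) : ℝ) := by
          calc _ ≤ t ^ 2 / 4 * W := by gcongr
            _ = _ := by rw [ht2]; push_cast; field_simp; ring
        have h2 : Real.exp (t ^ 2 / 4 * ∑ n ∈ s, b n ^ 2) ≤ Real.exp 1 ^ (2 * k) := by
          rw [← Real.exp_nat_mul, mul_one]
          exact Real.exp_le_exp.2 h1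
        calc _ ≤ D * (2 * Real.exp 1 ^ (2 * k)) := by gcongr
          _ = _ := by
            rw [hD]
            have e : 4 * k = 2 * (2 * k) := by ring
            have e2 : ((4 * k : ℕ) : ℝ) ^ (4 * k) = (16 * k ^ 2 : ℝ) ^ (2 * k) := by
              nth_rewrite 2 [e]
              rw [pow_mul]; push_cast; ring
            rw [e2]
            have e3 : 2 * (k : ℝ) * Real.exp 1 * W = W / (8 * k) * (16 * k ^ 2) * Real.exp 1 := by
              field_simp; ring
            rw [e3, mul_pow (W / (8 * k) * (16 * (k : ℝ) ^ 2)), mul_pow (W / (8 * (k : ℝ)))]; ring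

theorem lintegral_norm_sum_gaussianSequence_pow_le (b : ℕ → ℝ) (s : Finset ℕ) {W : ℝ} (hW : 0 < W)
    (hb : ∑ n ∈ s, b n ^ 2 ≤ W) {k : ℕ} (hk : 0 < k) :
    ∫⁻ g, ‖∑ n ∈ s, (b n : ℂ) * g n‖ₑ ^ (4 * k) ∂gaussianSequence ≤
      ENNReal.ofReal (2 * (128 * k ^ 2 * W ^ 2) ^ k) := by
  have hpt : ∀ g : ℕ → ℂ, ‖∑ n ∈ s, (b n : ℂ) * g n‖ₑ ^ (4 * k) ≤
      ENNReal.ofReal (2 ^ (2 * k - 1)) * (ENNReal.ofReal ((∑ n ∈ s, b n * (g n).re) ^ (4 * k)) +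
        ENNReal.ofReal ((∑ n ∈ s, b n * (g n).im) ^ (4 * k))) := by
    intro g
    have e : 4 * k = 2 * (2 * k) := by ring
    rw [← ofReal_norm, ← ENNReal.ofReal_pow (norm_nonneg _),
      ← ENNReal.ofReal_add (by rw [e, pow_mul]; positivity) (by rw [e, pow_mul]; positivity),
      ← ENNReal.ofReal_mul (by positivity)]
    refine ENNReal.ofReal_le_ofReal ?_
    set w := ∑ n ∈ s, (b n : ℂ) * g n with hw
    have h1 : w.re = ∑ n ∈ s, b n * (g n).re := by simp [hw]
    have h2 : w.im = ∑ n ∈ s, b n * (g n).im := by simp [hw]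
    rw [← h1, ← h2, e, pow_mul ‖w‖, pow_mul w.re, pow_mul w.im, Complex.sq_norm,
      Complex.normSq_apply, ← sq, ← sq]
    -- Convexity of the power `2k` separates real and imaginary parts.
    exact add_pow_le (sq_nonneg w.re) (sq_nonneg w.im) _
  have hm1 : Measurable fun g : ℕ → ℂ => ENNReal.ofReal ((∑ n ∈ s, b n * (g n).re) ^ (4 * k)) := by
    fun_prop
  have hm2 : Measurable fun g : ℕ → ℂ => ENNReal.ofReal ((∑ n ∈ s, b n * (g n).im) ^ (4 * k)) := by
    fun_prop
  calc _ ≤ _ := lintegral_mono hpt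
    _ = ENNReal.ofReal (2 ^ (2 * k - 1)) *
        (∫⁻ g, ENNReal.ofReal ((∑ n ∈ s, b n * (g n).re) ^ (4 * k)) ∂gaussianSequence +
        ∫⁻ g, ENNReal.ofReal ((∑ n ∈ s, b n * (g n).im) ^ (4 * k)) ∂gaussianSequence) := by
        rw [lintegral_const_mul _ (by fun_prop), lintegral_add_left hm1]
    _ ≤ ENNReal.ofReal (2 ^ (2 * k - 1)) *
        (ENNReal.ofReal (2 * (2 * k * Real.exp 1 * W) ^ (2 * k)) +
          ENNReal.ofReal (2 * (2 * k * Real.exp 1 * W) ^ (2 * k))) := by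
        gcongr
        · exact lintegral_sum_gaussianSequence_pow_le Complex.measurable_re
            map_re_complexGaussian b s hW hb hk
        · exact lintegral_sum_gaussianSequence_pow_le Complex.measurable_im
            map_im_complexGaussian b s hW hb hk
    _ = ENNReal.ofReal (2 * (16 * Real.exp 1 ^ 2 * k ^ 2 * W ^ 2) ^ k) := by
        rw [← ENNReal.ofReal_add (by positivity) (by positivity),
          ← ENNReal.ofReal_mul (by positivity)]
        congr 1
        obtain ⟨j, rfl⟩ : ∃ j, k = j + 1 := ⟨k - 1, by omega⟩
        have e1 : 2 * (j + 1) - 1 = 2 * j + 1 := by omega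
        rw [e1]
        have e2 : (16 * Real.exp 1 ^ 2 * ((j + 1 : ℕ) : ℝ) ^ 2 * W ^ 2) =
          2 ^ 2 * (2 * ((j + 1 : ℕ) : ℝ) * Real.exp 1 * W) ^ 2 := by ring
        rw [e2, mul_pow (2 ^ 2 : ℝ), ← pow_mul, ← pow_mul]
        ring
    _ ≤ _ := by
        refine ENNReal.ofReal_le_ofReal ?_
        have he : Real.exp 1 ^ 2 ≤ 8 := by
          have := Real.exp_one_lt_d9
          nlinarith [Real.exp_pos 1]
        have : 16 * Real.exp 1 ^ 2 ≤ 128 := by linarith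
        gcongr

/-! ### Variance and L⁴ moments of the high frequencies -/

/-- Hölder against the constant 1; it moves the power inside the spatial integral, so that moments
can be estimated point by point. -/
theorem lintegral_pow_le_measure_univ_pow_mul {α : Type*} [MeasurableSpace α] {ν : Measure α}
    {f : α → ℝ≥0∞} (hf : AEMeasurable f ν) {k : ℕ} (hk : 0 < k) :
    (∫⁻ x, f x ∂ν) ^ k ≤ ν Set.univ ^ (k - 1) * ∫⁻ x, f x ^ k ∂ν := by
  have hk0 : (0 : ℝ) < k := by exact_mod_cast hk
  have hk1 : (1 : ℝ) ≤ k := by exact_mod_cast hk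
  have h := eLpNorm'_le_eLpNorm'_mul_rpow_measure_univ (p := 1) (q := k) (f := f) (μ := ν) one_pos
    hk1 hf.aestronglyMeasurable
  simp only [eLpNorm'_eq_lintegral_enorm, enorm_eq_self, ENNReal.rpow_one, div_one,
    ENNReal.rpow_natCast, one_div] at h
  calc (∫⁻ x, f x ∂ν) ^ k ≤ ((∫⁻ x, f x ^ k ∂ν) ^ ((k : ℝ)⁻¹) *
        ν Set.univ ^ ((1 : ℝ) - (k : ℝ)⁻¹)) ^ k := by
        gcongr
    _ = _ := by
        rw [mul_pow, ← ENNReal.rpow_natCast, ← ENNReal.rpow_mul, inv_mul_cancel₀ hk0.ne',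
          ENNReal.rpow_one, ← ENNReal.rpow_natCast, ← ENNReal.rpow_mul, mul_comm]
        congr 1
        rw [← ENNReal.rpow_natCast, Nat.cast_sub hk]
        congr 1
        field_simp
        simp

theorem radialMode_div_sq_le (n : ℕ) {r : ℝ} (hr : 0 < r) :
    (radialMode n r / radialFreq n) ^ 2 ≤ 110 / (√r * √(n + 1) ^ 3) := by
  have hz := radialFreq_pos n
  have h1 := mul_radialMode_pow_four_le n hr.le
  have h2 := le_radialFreq n
  have hn : (0 : ℝ) < (n : ℝ) + 1 := by positivity
  refine le_of_sq_le_sq ?_ (by positivity)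
  -- From `r eₙ ^ 4 ≤ 9 zₙ` and `zₙ ≥ (n + 1) / 11`: the constant is `9 * 11 ^ 3 = 11979 ≤ 110 ^ 2`.
  have e1 : (110 / (√r * √(n + 1) ^ 3)) ^ 2 = 12100 / (r * (n + 1) ^ 3) := by
    rw [div_pow, mul_pow, ← pow_mul, Real.sq_sqrt hr.le, mul_comm 3 2, pow_mul √((n : ℝ) + 1),
      Real.sq_sqrt hn.le]
    norm_num
  have e2 : ((radialMode n r / radialFreq n) ^ 2) ^ 2 = radialMode n r ^ 4 / radialFreq n ^ 4 := by
    rw [← pow_mul, div_pow]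
  rw [e1, e2, div_le_div_iff₀ (by positivity) (by positivity)]
  have h3 : ((n : ℝ) + 1) ^ 3 ≤ (11 * radialFreq n) ^ 3 := by gcongr; linarith
  calc radialMode n r ^ 4 * (r * (n + 1) ^ 3) = (r * radialMode n r ^ 4) * (n + 1) ^ 3 := by ring
    _ ≤ (9 * radialFreq n) * (11 * radialFreq n) ^ 3 := by
        gcongr
    _ ≤ _ := by nlinarith [pow_pos hz 4]

/-- Telescoping majorant: with `a = √n` and `b = √(n + 1)`, `1 / a - 1 / b = 1 / (a b (a + b)) ≥ 1 /
(2 b ^ 3)`. -/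
theorem one_div_sqrt_succ_pow_three_le {n : ℕ} (hn : 0 < n) :
    1 / √((n : ℝ) + 1) ^ 3 ≤ 2 * (1 / √(n : ℝ) - 1 / √((n + 1 : ℕ) : ℝ)) := by
  have hn0 : (0 : ℝ) < n := by exact_mod_cast hn
  push_cast
  set a := √(n : ℝ) with ha
  set b := √((n : ℝ) + 1) with hb
  have ha0 : 0 < a := Real.sqrt_pos.2 hn0
  have hb0 : 0 < b := Real.sqrt_pos.2 (by linarith)
  have hab : a ≤ b := Real.sqrt_le_sqrt (by linarith)
  have ha2 : a ^ 2 = n := Real.sq_sqrt hn0.le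
  have hb2 : b ^ 2 = n + 1 := Real.sq_sqrt (by linarith)
  have h1 : (b - a) * (a + b) = 1 := by linear_combination hb2 - ha2
  have h2 : 1 / a - 1 / b = (b - a) / (a * b) := by field_simp
  rw [h2, div_le_iff₀ (by positivity)]
  have h3 : 2 * ((b - a) / (a * b)) * b ^ 3 = 2 * (b - a) * b ^ 2 / a := by field_simp
  rw [h3, le_div_iff₀ ha0]
  have h4 : 0 ≤ b - a := by linarith
  nlinarith [mul_nonneg h4 (mul_nonneg h4 hb0.le), mul_nonneg h4 ha0.le, mul_nonneg h4 h4]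

theorem sum_radialMode_div_sq_le {N : ℕ} (hN : 0 < N) (M : ℕ) {r : ℝ} (hr : 0 < r) :
    ∑ n ∈ Finset.Ico N M, (radialMode n r / radialFreq n) ^ 2 ≤ 220 / (√r * √(N : ℝ)) := by
  rcases le_or_gt N M with hNM | hNM
  swap
  · rw [Finset.Ico_eq_empty_of_le hNM.le, Finset.sum_empty]; positivity
  calc _ ≤ ∑ n ∈ Finset.Ico N M, 220 / √r * (1 / √(n : ℝ) - 1 / √((n + 1 : ℕ) : ℝ)) := by
        refine Finset.sum_le_sum fun n hn => ?_
        have hn0 : 0 < n := lt_of_lt_of_le hN (Finset.mem_Ico.1 hn).1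
        refine (radialMode_div_sq_le n hr).trans ?_
        calc 110 / (√r * √((n : ℝ) + 1) ^ 3) = 110 / √r * (1 / √((n : ℝ) + 1) ^ 3) := by
              field_simp
          _ ≤ 110 / √r * (2 * (1 / √(n : ℝ) - 1 / √((n + 1 : ℕ) : ℝ))) := by
              gcongr; exact one_div_sqrt_succ_pow_three_le hn0
          _ = _ := by ring
    _ = 220 / √r * (1 / √(N : ℝ) - 1 / √(M : ℝ)) := by
        rw [← Finset.mul_sum, Finset.sum_Ico_eq_sub _ hNM]
        rw [Finset.sum_range_sub' (fun n : ℕ => 1 / √(n : ℝ)),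
          Finset.sum_range_sub' (fun n : ℕ => 1 / √(n : ℝ))]
        ring
    _ ≤ 220 / √r * (1 / √(N : ℝ)) := by
        gcongr
        have : 0 ≤ 1 / √(M : ℝ) := by positivity
        linarith
    _ = _ := by field_simp

/-- The value at `x` of the sum over `n ∈ s` of `π⁻¹ (gₙ / zₙ) eₙ`. -/
noncomputable def partialField (s : Finset ℕ) (g : ℕ → ℂ) (x : Plane) : ℂ :=
  ∑ n ∈ s, ((Real.pi⁻¹ * (radialMode n ‖x‖ / radialFreq n) : ℝ) : ℂ) * g n

theorem measurable_partialField (s : Finset ℕ) :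
    Measurable fun p : (ℕ → ℂ) × Plane => partialField s p.1 p.2 := by
  have h := fun n => (continuous_radialMode n).measurable
  unfold partialField
  refine Finset.measurable_fun_sum _ fun n _ => ?_
  have := h n
  fun_prop

/-- The variance bound `W` satisfies `W ^ 2 = 48400 / (‖x‖ N)`, so the weight `‖x‖` makes the moment
bound uniform in `x`, and in `M`. The constant is `128 * 48400`. -/
theorem lintegral_partialField_pow_le {N : ℕ} (hN : 0 < N) (M : ℕ) {k : ℕ} (hk : 0 < k)
    {x : Plane} (hx : x ≠ 0) :
    ∫⁻ g, (‖partialField (Finset.Ico N M) g x‖ₑ ^ 4 * ENNReal.ofReal ‖x‖) ^ k ∂gaussianSequence ≤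
      ENNReal.ofReal (2 * (6195200 * k ^ 2 / N) ^ k) := by
  have hr : 0 < ‖x‖ := norm_pos_iff.2 hx
  have hN0 : (0 : ℝ) < N := by exact_mod_cast hN
  set W : ℝ := 220 / (√‖x‖ * √(N : ℝ)) with hW
  have hsum : ∑ n ∈ Finset.Ico N M, (Real.pi⁻¹ * (radialMode n ‖x‖ / radialFreq n)) ^ 2 ≤ W := by
    refine le_trans (Finset.sum_le_sum fun n _ => ?_) (sum_radialMode_div_sq_le hN M hr)
    rw [mul_pow]
    refine mul_le_of_le_one_left (sq_nonneg _) (pow_le_one₀ (by positivity) ?_)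
    exact inv_le_one_of_one_le₀ (by linarith [Real.pi_gt_three])
  have h := lintegral_norm_sum_gaussianSequence_pow_le
    (fun n => Real.pi⁻¹ * (radialMode n ‖x‖ / radialFreq n)) (Finset.Ico N M) (by positivity)
    hsum hk
  have hm : Measurable fun g : ℕ → ℂ => ‖partialField (Finset.Ico N M) g x‖ₑ ^ (4 * k) :=
    ((measurable_partialField _).comp (measurable_id.prodMk measurable_const)).enorm.pow_const _
  calc _ = ∫⁻ g, ‖partialField (Finset.Ico N M) g x‖ₑ ^ (4 * k) * ENNReal.ofReal ‖x‖ ^ k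
        ∂gaussianSequence := by simp_rw [mul_pow, ← pow_mul]
    _ = (∫⁻ g, ‖partialField (Finset.Ico N M) g x‖ₑ ^ (4 * k) ∂gaussianSequence) *
        ENNReal.ofReal ‖x‖ ^ k := lintegral_mul_const _ hm
    _ ≤ ENNReal.ofReal (2 * (128 * k ^ 2 * W ^ 2) ^ k) * ENNReal.ofReal ‖x‖ ^ k := by
        gcongr; exact h
    _ = _ := by
        rw [← ENNReal.ofReal_pow hr.le, ← ENNReal.ofReal_mul (by positivity), mul_assoc, ← mul_pow]
        congr 3
        rw [hW, div_pow, mul_pow, Real.sq_sqrt hr.le, Real.sq_sqrt hN0.le]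
        field_simp
        norm_num

instance instNullSingletonClassDiscMeasure : NullSingletonClass discMeasure := by
  unfold discMeasure; infer_instance

/-- The high-frequency part of the random series has small moments in `L⁴`. -/
theorem lintegral_lintegral_partialField_pow_le {N : ℕ} (hN : 0 < N) (M : ℕ) {k : ℕ} (hk : 0 < k) :
    ∫⁻ g, (∫⁻ x, ‖partialField (Finset.Ico N M) g x‖ₑ ^ 4 ∂discMeasure) ^ k ∂gaussianSequence ≤
      ENNReal.ofReal (2 * (40000000 * k ^ 2 / N) ^ k) := by
  have hN0 : (0 : ℝ) < N := by exact_mod_cast hN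
  set w : Plane → ℝ≥0∞ := fun x => ENNReal.ofReal ‖x‖⁻¹ with hw
  have hwm : Measurable w := by fun_prop
  -- Factor `|u| ^ 4 dx` as `(|u| ^ 4 ‖x‖) (dx / ‖x‖)`: the first factor has uniform moments, and
  -- the measure has mass `2 π`.
  set ν := discMeasure.withDensity w with hν
  have hνu : ν Set.univ = ENNReal.ofReal (2 * Real.pi) := by
    rw [hν, withDensity_apply _ MeasurableSet.univ, Measure.restrict_univ,
      lintegral_discMeasure_norm_inv]
  have hνfin : IsFiniteMeasure ν := ⟨by rw [hνu]; exact ENNReal.ofReal_lt_top⟩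
  set f : (ℕ → ℂ) → Plane → ℝ≥0∞ := fun g x =>
    ‖partialField (Finset.Ico N M) g x‖ₑ ^ 4 * ENNReal.ofReal ‖x‖ with hf
  have hfm : Measurable fun p : (ℕ → ℂ) × Plane => f p.1 p.2 :=
    ((measurable_partialField (Finset.Ico N M)).enorm.pow_const 4).mul
      (ENNReal.measurable_ofReal.comp (measurable_norm.comp measurable_snd))
  have hfg : ∀ g, Measurable (f g) := fun g =>
    (((measurable_partialField (Finset.Ico N M)).comp
      (measurable_const.prodMk measurable_id)).enorm.pow_const 4).mul
      (ENNReal.measurable_ofReal.comp measurable_norm)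
  have hae : ∀ᵐ x ∂discMeasure, x ≠ 0 := Measure.ae_ne discMeasure 0
  have haeν : ∀ᵐ x ∂ν, x ≠ 0 := (withDensity_absolutelyContinuous _ _).ae_le hae
  have e1 : ∀ g, ∫⁻ x, ‖partialField (Finset.Ico N M) g x‖ₑ ^ 4 ∂discMeasure =
      ∫⁻ x, f g x ∂ν := by
    intro g
    rw [hν, lintegral_withDensity_eq_lintegral_mul _ hwm (hfg g)]
    refine lintegral_congr_ae ?_
    filter_upwards [hae] with x hx
    have hr : 0 < ‖x‖ := norm_pos_iff.2 hx
    simp only [Pi.mul_apply, hw, hf]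
    rw [mul_comm, mul_assoc, ← ENNReal.ofReal_mul hr.le, mul_inv_cancel₀ hr.ne',
      ENNReal.ofReal_one, mul_one]
  calc _ = ∫⁻ g, (∫⁻ x, f g x ∂ν) ^ k ∂gaussianSequence := by simp_rw [e1]
    _ ≤ ∫⁻ g, ν Set.univ ^ (k - 1) * ∫⁻ x, f g x ^ k ∂ν ∂gaussianSequence :=
        lintegral_mono fun g => lintegral_pow_le_measure_univ_pow_mul (hfg g).aemeasurable hk
    _ = ν Set.univ ^ (k - 1) * ∫⁻ x, ∫⁻ g, f g x ^ k ∂gaussianSequence ∂ν := by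
        rw [lintegral_const_mul']
        · rw [lintegral_lintegral_swap]
          exact (hfm.pow_const k).aemeasurable
        · exact ENNReal.pow_ne_top (by rw [hνu]; exact ENNReal.ofReal_ne_top)
    _ ≤ ν Set.univ ^ (k - 1) * ∫⁻ x, ENNReal.ofReal (2 * (6195200 * k ^ 2 / N) ^ k) ∂ν := by
        gcongr 1
        refine lintegral_mono_ae ?_
        filter_upwards [haeν] with x hx
        exact lintegral_partialField_pow_le hN M hk hx
    _ = ν Set.univ ^ k * ENNReal.ofReal (2 * (6195200 * k ^ 2 / N) ^ k) := by
        rw [lintegral_const, mul_comm (ENNReal.ofReal _), ← mul_assoc, ← pow_succ,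
          Nat.sub_add_cancel hk]
    _ ≤ _ := by
        rw [hνu, ← ENNReal.ofReal_pow (by positivity), ← ENNReal.ofReal_mul (by positivity)]
        refine ENNReal.ofReal_le_ofReal ?_
        have e : (2 * Real.pi) ^ k * (2 * (6195200 * (k : ℝ) ^ 2 / N) ^ k) =
          2 * (2 * Real.pi * 6195200 * k ^ 2 / N) ^ k := by
          have e2 : 2 * Real.pi * 6195200 * (k : ℝ) ^ 2 / N =
            2 * Real.pi * (6195200 * k ^ 2 / N) := by ring
          rw [e2, mul_pow (2 * Real.pi)]; ring
        rw [e]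
        have : 2 * Real.pi * 6195200 ≤ 40000000 := by linarith [Real.pi_lt_d2]
        gcongr

/-! ### The L⁴ norm and the low/high splitting of the series -/

open Filter Topology in
-- Fatou along an almost everywhere convergent subsequence. It yields measurability and lets lower
-- bounds on the L⁴ norm pass from an L² limit to its truncations.
theorem lowerSemicontinuous_normL4 : LowerSemicontinuous normL4 := by
  rw [lowerSemicontinuous_iff_isClosed_preimage]
  intro y
  refine IsSeqClosed.isClosed fun φ ψ hφ hlim => ?_
  obtain ⟨ns, -, hns⟩ := (tendstoInMeasure_of_tendsto_Lp hlim).exists_seq_tendsto_ae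
  have h := Lp.eLpNorm_lim_le_liminf_eLpNorm (p := 4) (μ := discMeasure)
    (fun n => Lp.aestronglyMeasurable (φ (ns n))) ψ hns
  refine h.trans ?_
  have h2 : liminf (fun n => eLpNorm (φ (ns n)) 4 discMeasure) atTop ≤
      liminf (fun _ : ℕ => y) atTop :=
    liminf_le_liminf (Eventually.of_forall fun n => hφ (ns n))
  simpa using h2

theorem measurable_normL4 : Measurable normL4 := lowerSemicontinuous_normL4.measurable

theorem normL4_pow_four (φ : DiscL2) : normL4 φ ^ 4 = ∫⁻ x, ‖φ x‖ₑ ^ 4 ∂discMeasure := by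
  have h4 : ((4 : ℝ≥0∞)).toReal = ((4 : ℕ) : ℝ) := by norm_num
  rw [normL4, eLpNorm_eq_lintegral_rpow_enorm_toReal (by norm_num) (by norm_num), h4,
    ← ENNReal.rpow_natCast, ← ENNReal.rpow_mul, one_div,
    inv_mul_cancel₀ (by norm_num), ENNReal.rpow_one]
  simp_rw [ENNReal.rpow_natCast]

theorem normL4_add_le (φ ψ : DiscL2) : normL4 (φ + ψ) ≤ normL4 φ + normL4 ψ := by
  unfold normL4
  rw [eLpNorm_congr_ae (Lp.coeFn_add φ ψ)]
  exact eLpNorm_add_le (Lp.aestronglyMeasurable φ) (Lp.aestronglyMeasurable ψ) (by norm_num)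

/-- The coefficients of the random series. -/
noncomputable def fieldCoeff (g : ℕ → ℂ) (n : ℕ) : ℂ :=
  ((Real.pi⁻¹ : ℝ) : ℂ) * (g n / (radialFreq n : ℂ))

theorem norm_fieldCoeff_sq_mul_le (g : ℕ → ℂ) (n : ℕ) :
    ‖fieldCoeff g n‖ ^ 2 * radialFreq n ^ 2 ≤ ‖g n‖ ^ 2 := by
  have hz := radialFreq_pos n
  have hpi : Real.pi⁻¹ ≤ 1 := inv_le_one_of_one_le₀ (by linarith [Real.pi_gt_three])
  have e : ‖fieldCoeff g n‖ * radialFreq n = Real.pi⁻¹ * ‖g n‖ := by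
    rw [fieldCoeff, norm_mul, norm_div, Complex.norm_real, Complex.norm_real, Real.norm_eq_abs,
      Real.norm_eq_abs, abs_of_pos hz, abs_of_pos (inv_pos.2 Real.pi_pos)]
    field_simp
  rw [← mul_pow, e, mul_pow]
  exact mul_le_of_le_one_left (sq_nonneg _) (pow_le_one₀ (by positivity) hpi)

/-- The partial sums of the random series. -/
noncomputable def partialSeries (s : Finset ℕ) (g : ℕ → ℂ) : DiscL2 :=
  ∑ n ∈ s, fieldCoeff g n • radialEigenfunction n

theorem partialSeries_ae_eq (s : Finset ℕ) (g : ℕ → ℂ) :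
    ∀ᵐ x ∂discMeasure, partialSeries s g x = partialField s g x := by
  classical
  induction s using Finset.induction_on with
  | empty =>
    filter_upwards [Lp.coeFn_zero ℂ 2 discMeasure] with x hx
    simpa [partialSeries, partialField] using hx
  | insert n s hn ih =>
    have e : partialSeries (insert n s) g =
        fieldCoeff g n • radialEigenfunction n + partialSeries s g := by
      simp [partialSeries, Finset.sum_insert hn]
    rw [e]
    filter_upwards [ih, Lp.coeFn_add (fieldCoeff g n • radialEigenfunction n) (partialSeries s g),
      Lp.coeFn_smul (fieldCoeff g n) (radialEigenfunction n), radialEigenfunction_ae_eq n]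
      with x h1 h2 h3 h4
    rw [h2, Pi.add_apply, h3, Pi.smul_apply, h1, h4, partialField, partialField,
      Finset.sum_insert hn, fieldCoeff]
    congr 1
    push_cast
    rw [smul_eq_mul]; ring

theorem normL4_partialSeries_pow_four (s : Finset ℕ) (g : ℕ → ℂ) :
    normL4 (partialSeries s g) ^ 4 = ∫⁻ x, ‖partialField s g x‖ₑ ^ 4 ∂discMeasure := by
  rw [normL4_pow_four]
  refine lintegral_congr_ae ?_
  filter_upwards [partialSeries_ae_eq s g] with x hx
  rw [hx]

/-- In the Dirichlet energy the factor `zₙ` cancels the weight `1 / zₙ`, so only the Gaussian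
variables remain. -/
theorem normL4_partialSeries_pow_four_le (s : Finset ℕ) (g : ℕ → ℂ) :
    normL4 (partialSeries s g) ^ 4 ≤
      ENNReal.ofReal (2 * ((∑ n ∈ s, ‖fieldCoeff g n‖ ^ 2) * ∑ n ∈ s, ‖g n‖ ^ 2)) := by
  rw [normL4_partialSeries_pow_four]
  have e : ∀ x, partialField s g x = ∑ n ∈ s, fieldCoeff g n * (radialMode n ‖x‖ : ℂ) := by
    intro x
    refine Finset.sum_congr rfl fun n _ => ?_
    rw [fieldCoeff]; push_cast; ring
  simp_rw [e]
  refine (lintegral_sum_radialMode_pow_four_le s (fieldCoeff g)).trans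
    (ENNReal.ofReal_le_ofReal ?_)
  gcongr with n _
  exact norm_fieldCoeff_sq_mul_le g n

theorem randomSeries_eq_tsum (g : ℕ → ℂ) :
    randomSeries g = ∑' n, fieldCoeff g n • radialEigenfunction n := by
  rw [randomSeries, ← tsum_const_smul'']
  simp_rw [smul_smul]
  rfl

open Filter Topology in
-- Bessel's inequality: summability identifies the coefficients as inner products with the sum. Thus
-- the L² cutoff bounds every partial sum.
theorem sum_norm_fieldCoeff_sq_le {g : ℕ → ℂ}
    (h : Summable fun n => fieldCoeff g n • radialEigenfunction n) (s : Finset ℕ) :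
    ∑ n ∈ s, ‖fieldCoeff g n‖ ^ 2 ≤ ‖randomSeries g‖ ^ 2 := by
  have horth := orthonormal_radialEigenfunction
  have hin : ∀ n, inner ℂ (radialEigenfunction n) (randomSeries g) = fieldCoeff g n := by
    intro n
    rw [randomSeries_eq_tsum]
    have h1 := h.hasSum.mapL (innerSL ℂ (radialEigenfunction n))
    have h2 : (fun m => innerSL ℂ (radialEigenfunction n)
        (fieldCoeff g m • radialEigenfunction m)) =
        fun m => if m = n then fieldCoeff g n else 0 := by
      ext m
      rw [innerSL_apply_apply, inner_smul_right, orthonormal_iff_ite.1 horth n m]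
      by_cases hnm : m = n
      · simp [hnm]
      · rw [if_neg (Ne.symm hnm), if_neg hnm, mul_zero]
    rw [h2] at h1
    exact h1.unique (hasSum_ite_eq n _)
  have := horth.sum_inner_products_le (x := randomSeries g) (s := s)
  simpa only [hin] using this

open Filter Topology in
/-- If the random series is large in `L⁴`, then its low-frequency part is large or all late
truncations of its high-frequency part are large. -/
theorem lt_normL4_partialSeries_or {g : ℕ → ℂ} {l : ℝ} (hl : 0 < l)
    (h : Summable fun n => fieldCoeff g n • radialEigenfunction n)
    (hg : ENNReal.ofReal l < normL4 (randomSeries g)) (N : ℕ) :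
    ENNReal.ofReal (l / 2) < normL4 (partialSeries (Finset.range N) g) ∨
      ∀ᶠ M in atTop, ENNReal.ofReal (l / 2) < normL4 (partialSeries (Finset.Ico N M) g) := by
  by_contra! hc
  obtain ⟨h1, h2⟩ := hc
  set ψ := randomSeries g - partialSeries (Finset.range N) g with hψ
  have h3 : ENNReal.ofReal (l / 2) < normL4 ψ := by
    by_contra! h4
    have h5 := normL4_add_le (partialSeries (Finset.range N) g) ψ
    have h6 : partialSeries (Finset.range N) g + ψ = randomSeries g := by rw [hψ]; abel
    rw [h6] at h5
    have h7 : ENNReal.ofReal l = ENNReal.ofReal (l / 2) + ENNReal.ofReal (l / 2) := by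
      rw [← ENNReal.ofReal_add (by positivity) (by positivity)]; congr 1; ring
    rw [h7] at hg
    exact absurd (hg.trans_le (h5.trans (add_le_add h1 h4))) (lt_irrefl _)
  have hlim : Tendsto (fun M => partialSeries (Finset.Ico N M) g) atTop (𝓝 ψ) := by
    have h4 : Tendsto (fun M => partialSeries (Finset.range M) g) atTop (𝓝 (randomSeries g)) := by
      rw [randomSeries_eq_tsum]
      exact h.hasSum.tendsto_sum_nat
    refine (h4.sub_const (partialSeries (Finset.range N) g)).congr' ?_
    filter_upwards [eventually_ge_atTop N] with M hM
    simp only [partialSeries]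
    rw [Finset.sum_Ico_eq_sub _ hM]
  -- The truncations converge to `ψ` in L² only; lower semicontinuity makes `l / 2 < normL4` an open
  -- condition, so no L⁴ convergence is needed.
  exact h2 ((hlim.eventually (lowerSemicontinuous_normL4 ψ _ h3)).mono fun M hM => not_le.2 hM)

/-- The event is the increasing union of the tail intersections, each contained in some `S n`;
continuity from below keeps the bound `B`. -/
theorem measure_eventually_le {α : Type*} [MeasurableSpace α] {μ : Measure α} {S : ℕ → Set α}
    {B : ℝ≥0∞} (h : ∀ M, μ (S M) ≤ B) : μ {a | ∀ᶠ M in Filter.atTop, a ∈ S M} ≤ B := by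
  have e : {a | ∀ᶠ M in Filter.atTop, a ∈ S M} = ⋃ n, ⋂ M ≥ n, S M := by
    ext a; simp [Filter.eventually_atTop]
  rw [e, Monotone.measure_iUnion]
  · exact iSup_le fun n => (measure_mono (Set.biInter_subset_of_mem (le_refl n))).trans (h n)
  · intro n m hnm
    exact Set.biInter_subset_biInter_left fun M hM => le_trans hnm hM

/-- Markov's inequality for the `k`-th moment at threshold `(l / 2) ^ 4 = l ^ 4 / 16`. -/
theorem measure_high_frequency_le {N : ℕ} (hN : 0 < N) (M : ℕ) {k : ℕ} (hk : 0 < k) {l : ℝ}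
    (hl : 0 < l) :
    gaussianSequence {g | ENNReal.ofReal (l / 2) < normL4 (partialSeries (Finset.Ico N M) g)} ≤
      ENNReal.ofReal (2 * (640000000 * k ^ 2 / (N * l ^ 4)) ^ k) := by
  have hN0 : (0 : ℝ) < N := by exact_mod_cast hN
  set H : (ℕ → ℂ) → ℝ≥0∞ := fun g =>
    (∫⁻ x, ‖partialField (Finset.Ico N M) g x‖ₑ ^ 4 ∂discMeasure) ^ k with hH
  have hHm : Measurable H :=
    (Measurable.lintegral_prod_right' ((measurable_partialField _).enorm.pow_const 4)).pow_const k
  set ε : ℝ≥0∞ := ENNReal.ofReal ((l ^ 4 / 16) ^ k) with hε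
  have hε0 : ε ≠ 0 := by rw [hε, ne_eq, ENNReal.ofReal_eq_zero, not_le]; positivity
  have hsub : {g | ENNReal.ofReal (l / 2) < normL4 (partialSeries (Finset.Ico N M) g)} ⊆
      {g | ε ≤ H g} := by
    intro g hg
    simp only [Set.mem_ofPred_eq] at hg ⊢
    rw [hH, hε, ENNReal.ofReal_pow (by positivity)]
    simp only
    rw [← normL4_partialSeries_pow_four]
    have e : l ^ 4 / 16 = (l / 2) ^ 4 := by ring
    rw [e, ENNReal.ofReal_pow (by positivity)]
    gcongr
  calc _ ≤ gaussianSequence {g | ε ≤ H g} := measure_mono hsub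
    _ ≤ (∫⁻ g, H g ∂gaussianSequence) / ε :=
        meas_ge_le_lintegral_div hHm.aemeasurable hε0 ENNReal.ofReal_ne_top
    _ ≤ ENNReal.ofReal (2 * (40000000 * k ^ 2 / N) ^ k) / ε := by
        gcongr
        exact lintegral_lintegral_partialField_pow_le hN M hk
    _ = _ := by
        rw [hε, ← ENNReal.ofReal_div_of_pos (by positivity), mul_div_assoc, ← div_pow]
        congr 3
        field_simp
        norm_num

/-! ### Tail bound for the free measure -/

theorem measurableSet_largeL4 (l ρ : ℝ) :
    MeasurableSet {φ : DiscL2 | ENNReal.ofReal l < normL4 φ ∧ ‖φ‖ < ρ} :=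
  (measurableSet_lt measurable_const measurable_normL4).inter
    (measurableSet_lt measurable_norm measurable_const)

/-- Reduction of the tail bound to the low-frequency and the high-frequency events. -/
theorem freeMeasure_largeL4_le {l ρ : ℝ} (hl : 0 < l) (hρ : 0 < ρ) {N k : ℕ} (hN : 0 < N)
    (hk : 0 < k) :
    freeMeasure {φ | ENNReal.ofReal l < normL4 φ ∧ ‖φ‖ < ρ} ≤
      gaussianSequence {g | l ^ 4 / (32 * ρ ^ 2) ≤ ∑ n ∈ Finset.range N, ‖g n‖ ^ 2} +
        ENNReal.ofReal (2 * (640000000 * k ^ 2 / (N * l ^ 4)) ^ k) := by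
  rw [freeMeasure, Measure.map_apply measurable_randomSeries (measurableSet_largeL4 l ρ)]
  refine le_trans (measure_mono (t := {g | l ^ 4 / (32 * ρ ^ 2) ≤
    ∑ n ∈ Finset.range N, ‖g n‖ ^ 2} ∪ {g | ∀ᶠ M in Filter.atTop, g ∈
      {g | ENNReal.ofReal (l / 2) < normL4 (partialSeries (Finset.Ico N M) g)}}) ?_)
    ((measure_union_le _ _).trans (add_le_add le_rfl
      (measure_eventually_le fun M => measure_high_frequency_le hN M hk hl)))
  rintro g ⟨hg1, hg2⟩
  by_cases hs : Summable fun n => fieldCoeff g n • radialEigenfunction n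
  swap
  -- A divergent series has sum 0 by convention, hence is never large; almost sure convergence is
  -- not needed.
  · rw [randomSeries_eq_tsum, tsum_eq_zero_of_not_summable hs] at hg1
    have : normL4 0 = 0 := by
      rw [normL4, eLpNorm_congr_ae (Lp.coeFn_zero ℂ 2 discMeasure)]; exact eLpNorm_zero
    rw [this] at hg1
    exact absurd hg1 not_lt_zero
  refine (lt_normL4_partialSeries_or hl hs hg1 N).imp (fun h => ?_) id
  have h1 := (pow_le_pow_left₀ zero_le h.le 4).trans (normL4_partialSeries_pow_four_le _ g)
  rw [← ENNReal.ofReal_pow (by positivity), ENNReal.ofReal_le_ofReal_iff (by positivity)] at h1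
  have h2 := sum_norm_fieldCoeff_sq_le hs (Finset.range N)
  have h3 : ‖randomSeries g‖ ^ 2 ≤ ρ ^ 2 := by gcongr
  have h4 : 0 ≤ ∑ n ∈ Finset.range N, ‖g n‖ ^ 2 := Finset.sum_nonneg fun n _ => by positivity
  simp only [Set.mem_ofPred_eq]
  rw [div_le_iff₀ (by positivity)]
  -- The low part being large reads `l ^ 4 / 16 ≤ 2 ρ ^ 2 ∑ ‖gₙ‖ ^ 2`, whence the factor 32.
  nlinarith [mul_le_mul_of_nonneg_right (h2.trans h3) h4]

theorem exists_freeMeasure_largeL4_le :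
    ∃ ρ₀ : ℝ, 0 < ρ₀ ∧ ∀ ρ : ℝ, 0 < ρ → ρ < ρ₀ → ∀ l : ℝ, 0 < l →
      freeMeasure {φ | ENNReal.ofReal l < normL4 φ ∧ ‖φ‖ < ρ} ≤
        ENNReal.ofReal (Real.exp 2 * Real.exp (-2 * l ^ 4)) := by
  obtain ⟨κ, K, hκ, hK, hlow⟩ := exists_measure_sum_norm_sq_le
  have hlogK : 0 ≤ Real.log K := Real.log_nonneg hK
  -- `K ^ N` costs at most `40000000000 l ^ 4 log K` in the exponent; the choice of `ρ₀` makes the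
  -- gain at least `L l ^ 4`, leaving `-2 l ^ 4`.
  set L : ℝ := 2 + 40000000000 * Real.log K with hL
  have hL0 : 0 < L := by positivity
  refine ⟨√(κ / (32 * L)), by positivity, fun ρ hρ hρ0 l hl => ?_⟩
  -- For `l < 1` the bound exceeds 1 because of the prefactor `exp 2`; for `l ≥ 1` rounding up is
  -- harmless.
  rcases lt_or_ge l 1 with hl1 | hl1
  · refine prob_le_one.trans ?_
    rw [← Real.exp_add, ENNReal.one_le_ofReal, Real.one_le_exp_iff]
    have : l ^ 4 ≤ 1 := pow_le_one₀ hl.le hl1.le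
    linarith
  have hl4 : 1 ≤ l ^ 4 := one_le_pow₀ hl1
  have hρ2 : ρ ^ 2 ≤ κ / (32 * L) := by
    have := pow_le_pow_left₀ hρ.le hρ0.le 2
    rwa [Real.sq_sqrt (by positivity)] at this
  -- With `2 l ^ 4 ≤ k ≤ 3 l ^ 4`, this `N` makes the base of the high-frequency bound at most
  -- `0.288 < 1 / 3 < exp(-1)`, so its `k`-th power is at most `exp(-2 l ^ 4)`.
  set N := ⌈20000000000 * l ^ 4⌉₊ with hN
  set k := ⌈2 * l ^ 4⌉₊ with hk
  have hN1 : 20000000000 * l ^ 4 ≤ N := Nat.le_ceil _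
  have hN2 : (N : ℝ) ≤ 40000000000 * l ^ 4 := by
    have := Nat.ceil_lt_add_one (by positivity : 0 ≤ 20000000000 * l ^ 4)
    linarith
  have hk1 : 2 * l ^ 4 ≤ k := Nat.le_ceil _
  have hk2 : (k : ℝ) ≤ 3 * l ^ 4 := by
    have := Nat.ceil_lt_add_one (by positivity : 0 ≤ 2 * l ^ 4)
    linarith
  have hNpos : 0 < N := Nat.ceil_pos.2 (by positivity)
  have hkpos : 0 < k := Nat.ceil_pos.2 (by positivity)
  have hN0 : (0 : ℝ) < N := by exact_mod_cast hNpos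
  have hA : gaussianSequence {g | l ^ 4 / (32 * ρ ^ 2) ≤ ∑ n ∈ Finset.range N, ‖g n‖ ^ 2} ≤
      ENNReal.ofReal (Real.exp (-2 * l ^ 4)) := by
    refine (hlow N _).trans (ENNReal.ofReal_le_ofReal ?_)
    have e : K ^ N = Real.exp (N * Real.log K) := by
      rw [Real.exp_nat_mul, Real.exp_log (by linarith)]
    rw [e, ← Real.exp_add, Real.exp_le_exp]
    have h1 : L * l ^ 4 ≤ κ * (l ^ 4 / (32 * ρ ^ 2)) := by
      rw [← mul_div_assoc, le_div_iff₀ (by positivity)]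
      rw [le_div_iff₀ (by positivity)] at hρ2
      nlinarith
    have h2 : N * Real.log K ≤ 40000000000 * l ^ 4 * Real.log K :=
      mul_le_mul_of_nonneg_right hN2 hlogK
    have h3 : L * l ^ 4 = 2 * l ^ 4 + 40000000000 * l ^ 4 * Real.log K := by rw [hL]; ring
    linarith
  have hB : 2 * (640000000 * (k : ℝ) ^ 2 / (N * l ^ 4)) ^ k ≤ 2 * Real.exp (-2 * l ^ 4) := by
    have hq : 640000000 * (k : ℝ) ^ 2 / (N * l ^ 4) ≤ Real.exp (-1) := by
      have h1 : 640000000 * (k : ℝ) ^ 2 / (N * l ^ 4) ≤ 1 / 3 := by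
        rw [div_le_iff₀ (by positivity)]
        have h2 : (k : ℝ) ^ 2 ≤ (3 * l ^ 4) ^ 2 := by gcongr
        have h3 : 20000000000 * l ^ 4 * l ^ 4 ≤ N * l ^ 4 := by gcongr
        nlinarith [sq_nonneg (l ^ 4)]
      have h2 : Real.exp (-1) = 1 / Real.exp 1 := by rw [Real.exp_neg, one_div]
      rw [h2]
      refine h1.trans (one_div_le_one_div_of_le (Real.exp_pos _) ?_)
      linarith [Real.exp_one_lt_d9]
    have h3 : Real.exp (-1) ^ k ≤ Real.exp (-2 * l ^ 4) := by
      rw [← Real.exp_nat_mul, Real.exp_le_exp]; linarith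
    have h4 := pow_le_pow_left₀ (by positivity) hq k
    linarith
  calc _ ≤ _ := freeMeasure_largeL4_le hl hρ hNpos hkpos
    _ ≤ ENNReal.ofReal (Real.exp (-2 * l ^ 4)) + ENNReal.ofReal (2 * Real.exp (-2 * l ^ 4)) :=
        add_le_add hA (ENNReal.ofReal_le_ofReal hB)
    _ ≤ _ := by
        rw [← ENNReal.ofReal_add (by positivity) (by positivity)]
        refine ENNReal.ofReal_le_ofReal ?_
        have h3 : 3 ≤ Real.exp 2 := by linarith [Real.add_one_le_exp (2 : ℝ)]
        nlinarith [Real.exp_pos (-2 * l ^ 4)]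

/-! ### Integrability of the focusing density -/

/-- A layer-cake bound for the exponential. -/
theorem exp_coe_le_one_add_tsum (X : ℝ≥0∞) :
    EReal.exp (X : EReal) ≤ 1 + ∑' m : ℕ, ENNReal.ofReal (Real.exp (m + 1)) *
      (Set.Ioi (m : ℝ≥0∞)).indicator 1 X := by
  rcases eq_or_ne X 0 with rfl | hX0
  · simp
  have hone : ∀ m : ℕ, (1 : ℝ≥0∞) ≤ ENNReal.ofReal (Real.exp (m + 1)) := fun m => by
    rw [ENNReal.one_le_ofReal]; exact Real.one_le_exp (by positivity)
  rcases eq_or_ne X ⊤ with rfl | hX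
  · have : ∑' m : ℕ, ENNReal.ofReal (Real.exp (m + 1)) *
        (Set.Ioi (m : ℝ≥0∞)).indicator 1 (⊤ : ℝ≥0∞) = ⊤ := by
      rw [eq_top_iff, ← ENNReal.tsum_const_eq_top_of_ne_zero (α := ℕ) one_ne_zero]
      refine ENNReal.tsum_le_tsum fun m => ?_
      rw [Set.indicator_of_mem (by simp)]
      simpa using hone m
    rw [this]; simp
  lift X to ℝ≥0 using hX
  have hXpos : 0 < X := pos_iff_ne_zero.2 (by simpa using hX0)
  obtain ⟨m, hm⟩ : ∃ m, ⌈X⌉₊ = m + 1 := Nat.exists_eq_succ_of_ne_zero (Nat.ceil_pos.2 hXpos).ne'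
  have h1 : (m : ℝ≥0) < X := by
    refine Nat.lt_ceil.1 ?_
    omega
  have h2 : X ≤ (m : ℝ≥0) + 1 := by
    have := Nat.le_ceil X
    rw [hm] at this
    exact_mod_cast this
  -- One term suffices: `m = ⌈X⌉ - 1` satisfies `m < X ≤ m + 1`.
  refine le_trans ?_ ((ENNReal.le_tsum m).trans le_add_self)
  rw [Set.indicator_of_mem (by simpa using by exact_mod_cast h1)]
  have e : (((X : ℝ≥0∞)) : EReal) = ((X : ℝ) : EReal) := rfl
  rw [e, EReal.exp_coe, Pi.one_apply, mul_one]
  refine ENNReal.ofReal_le_ofReal (Real.exp_le_exp.2 ?_)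
  exact_mod_cast h2

theorem focusingDensity_le (ρ : ℝ) (φ : DiscL2) :
    focusingDensity ρ φ ≤ 1 + ∑' m : ℕ, ENNReal.ofReal (Real.exp (m + 1)) *
      {φ : DiscL2 | (m : ℝ≥0∞) < normL4 φ ^ 4 ∧ ‖φ‖ < ρ}.indicator 1 φ := by
  by_cases hφ : ‖φ‖ < ρ
  · rw [focusingDensity, Set.indicator_of_mem (by exact hφ), ← normL4_pow_four]
    refine (exp_coe_le_one_add_tsum _).trans (le_of_eq ?_)
    congr 1
    refine tsum_congr fun m => ?_
    congr 1
    simp [Set.indicator, hφ]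
  · rw [focusingDensity, Set.indicator_of_notMem (by exact hφ)]
    exact zero_le

/-- The layer `m` contributes at most a constant times `exp(m) exp(-2 m)`, a geometric series; a
decay rate above 1 is what makes this converge. -/
theorem isFiniteMeasure_focusing {ρ A : ℝ}
    (h : ∀ l : ℝ, 0 < l → freeMeasure {φ | ENNReal.ofReal l < normL4 φ ∧ ‖φ‖ < ρ} ≤
      ENNReal.ofReal (A * Real.exp (-2 * l ^ 4))) :
    IsFiniteMeasure (freeMeasure.withDensity (focusingDensity ρ)) := by
  refine ⟨?_⟩
  rw [withDensity_apply _ MeasurableSet.univ, Measure.restrict_univ]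
  have hmeas : ∀ m : ℕ, MeasurableSet {φ : DiscL2 | (m : ℝ≥0∞) < normL4 φ ^ 4 ∧ ‖φ‖ < ρ} :=
    fun m => (measurableSet_lt measurable_const (measurable_normL4.pow_const 4)).inter
      (measurableSet_lt measurable_norm measurable_const)
  have hm : ∀ m : ℕ, Measurable fun φ : DiscL2 => ENNReal.ofReal (Real.exp (m + 1)) *
      {φ : DiscL2 | (m : ℝ≥0∞) < normL4 φ ^ 4 ∧ ‖φ‖ < ρ}.indicator 1 φ := fun m =>
    (measurable_const.indicator (hmeas m)).const_mul _
  have hbound : ∀ m : ℕ, freeMeasure {φ : DiscL2 | (m : ℝ≥0∞) < normL4 φ ^ 4 ∧ ‖φ‖ < ρ} ≤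
      -- The hypothesis needs `l > 0`, so the layer `m = 0` is bounded by total mass 1, whence the
      -- maximum; for `m > 0` take `l = m ^ (1/4)`.
      ENNReal.ofReal (max A 1 * Real.exp (-2 * m)) := by
    intro m
    rcases Nat.eq_zero_or_pos m with rfl | hm0
    · refine prob_le_one.trans ?_
      rw [ENNReal.one_le_ofReal]; simp
    have hm1 : (0 : ℝ) < m := by exact_mod_cast hm0
    set l : ℝ := √√(m : ℝ) with hl
    have hl0 : 0 < l := by positivity
    have hl4 : l ^ 4 = m := by
      have : l ^ 4 = (l ^ 2) ^ 2 := by ring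
      rw [this, hl, Real.sq_sqrt (Real.sqrt_nonneg _), Real.sq_sqrt hm1.le]
    refine (measure_mono ?_).trans ((h l hl0).trans (ENNReal.ofReal_le_ofReal ?_))
    · rintro φ ⟨h1, h2⟩
      refine ⟨?_, h2⟩
      by_contra! hc
      have h3 := pow_le_pow_left₀ zero_le hc 4
      rw [← ENNReal.ofReal_pow hl0.le, hl4, ENNReal.ofReal_natCast] at h3
      exact absurd (lt_of_lt_of_le h1 h3) (lt_irrefl _)
    · rw [hl4]
      gcongr
      exact le_max_left _ _
  calc ∫⁻ φ, focusingDensity ρ φ ∂freeMeasure ≤ ∫⁻ φ, (1 + ∑' m : ℕ,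
        ENNReal.ofReal (Real.exp (m + 1)) *
          {φ : DiscL2 | (m : ℝ≥0∞) < normL4 φ ^ 4 ∧ ‖φ‖ < ρ}.indicator 1 φ) ∂freeMeasure :=
        lintegral_mono fun φ => focusingDensity_le ρ φ
    _ = 1 + ∑' m : ℕ, ENNReal.ofReal (Real.exp (m + 1)) *
          freeMeasure {φ : DiscL2 | (m : ℝ≥0∞) < normL4 φ ^ 4 ∧ ‖φ‖ < ρ} := by
        rw [lintegral_add_left measurable_const, lintegral_tsum fun m => (hm m).aemeasurable]
        congr 1
        · simp
        · refine tsum_congr fun m => ?_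
          rw [lintegral_const_mul _ (measurable_one.indicator (hmeas m)),
            lintegral_indicator_one (hmeas m)]
    _ ≤ 1 + ∑' m : ℕ, ENNReal.ofReal (Real.exp 1 * max A 1 * Real.exp (-1) ^ m) := by
        gcongr with m
        refine (mul_le_mul_right (hbound m) _).trans (le_of_eq ?_)
        rw [← ENNReal.ofReal_mul (Real.exp_pos _).le]
        congr 1
        have : Real.exp (m + 1) * Real.exp (-2 * m) = Real.exp 1 * Real.exp (-1) ^ m := by
          rw [← Real.exp_nat_mul, ← Real.exp_add, ← Real.exp_add]; congr 1; ring
        linear_combination (max A 1) * this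
    _ < ⊤ := by
        refine ENNReal.add_lt_top.2 ⟨ENNReal.one_lt_top, ?_⟩
        have hs : Summable fun m : ℕ => Real.exp 1 * max A 1 * Real.exp (-1) ^ m :=
          (summable_geometric_of_lt_one (Real.exp_pos _).le (by simp)).mul_left _
        exact hs.tsum_ofReal_lt_top

end RadialDisc

theorem proposition6p1 :
    ∃ ρ₀ : ℝ, 0 < ρ₀ ∧ ∃ C A : ℝ, 1 < C ∧ ∀ ρ : ℝ, 0 < ρ → ρ < ρ₀ →
      (∀ l : ℝ, 0 < l →
        RadialDisc.freeMeasure {φ | ENNReal.ofReal l < RadialDisc.normL4 φ ∧ ‖φ‖ < ρ} ≤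
          ENNReal.ofReal (A * Real.exp (-C * l ^ 4))) ∧
      MeasureTheory.IsFiniteMeasure
        (RadialDisc.freeMeasure.withDensity (RadialDisc.focusingDensity ρ)) := by
  obtain ⟨ρ₀, hρ₀, h⟩ := RadialDisc.exists_freeMeasure_largeL4_le
  exact ⟨ρ₀, hρ₀, 2, Real.exp 2, one_lt_two, fun ρ hρ hlt =>
    ⟨h ρ hρ hlt, RadialDisc.isFiniteMeasure_focusing (h ρ hρ hlt)⟩⟩
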